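/- Let $k_{h,1},k_{h,2},k_z,\Delta_z>0$ be constants and let $\alpha:[0,\infty)\to(0,1]$ be a strictly decreasing, twice differentiable function with $\alpha(0)=1$, $\alpha'(0)=0$, $\alpha(x)\le \Delta_z/x$ for $x>0$ and $\lim_{x\to\infty}\alpha(x)x=\Delta_z$; put $\overline{\mathrm{sat}}(y)=\alpha(|y|)y$ for $y\in\mathbb R^3$. Let the desired heading $h^*:[0,\infty)\to\mathbb R^3$ be a differentiable curve of unit vectors, with angular velocity $\omega_{h^*}=h^*\times\dot h^*$. For a unit vector $h$ (the heading) and $z\in\mathbb R^3$ put $\tilde h=h\times h^*$, $\alpha_h=\alpha(|z+\tilde h/k_z|)$, and $$\bar\omega_h=\omega_{h^*}+k_{h,1}\tilde h+k_{h,2}\,\alpha_h z .$$ Consider on $[0,\infty)$ the heading/integrator system $$\dot h=\omega_h\times h,\qquad \omega_h=\Pi_h\bar\omega_h+o(t),\qquad \dot z=\omega_{h^*}\times z+k_z\bigl(-z+\overline{\mathrm{sat}}(z+\tilde h/k_z)\bigr),\qquad z(0)=0,$$ where $\Pi_h x=x-(h\cdot x)h$ and the residual $o$ is such that $\int_0^t|o(s)|\,ds$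 is bounded in $t\geq 0$. (If $o\equiv 0$, a solution with $z(0)=0$ keeps $z\cdot h^*\equiv0$, so that the states of this system are the pairs $(h,z)$ with $|h|=1$ and $z\cdot h^*=0$.) Case 1: $o\equiv 0$. (a) The system, without the initial condition on $z$, has exactly two equilibria, where an equilibrium is a solution on $[0,\infty)$ along which $h$ and $z$ are at rest in a frame rotating with angular velocity $\omega_{h^*}$ (that is, $\dot h=\omega_{h^*}\times h$ and $\dot z=\omega_{h^*}\times z$): namely $(h,z)=(h^*,0)$ and $(h,z)=(-h^*,0)$. (b) $(h^*,0)$ is locally exponentially stable: there are $\delta,K,\lambda>0$, depending only on $k_{h,1},k_{h,2},k_z,\Delta_z,\alpha$, such that for every $t_0\ge0$ every solution on $[t_0,\infty)$ with $z(t_0)\cdot h^*(t_0)=0$ and $|h(t_0)-h^*(t_0)|+|z(t_0)|<\delta$ satisfies $|h(t)-h^*(t)|+|z(t)|\le Ke^{-\lambda(t-t_0)}\bigl(|h(t_0)-h^*(t_0)|+|z(t_0)|\bigr)$ for all $t\ge t_0$. (c) If $h^*$ is continuously differentiable, $(-h^*,0)$ is unstable: for every $t_0\geq 0$ there is $\varepsilon>0$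 such that for every $\delta>0$ there is a solution on $[t_0,\infty)$ with $z(t_0)=0$ and $|h(t_0)+h^*(t_0)|<\delta$ for which $|h(t)+h^*(t)|+|z(t)|\ge\varepsilon$ at some $t\ge t_0$. (d) Every solution on $[0,\infty)$ with $z(0)=0$ and $h(0)\ne-h^*(0)$ converges to $(h^*,0)$, i.e. $|h(t)-h^*(t)|+|z(t)|\to0$ as $t\to\infty$. Case 2: $o\not\equiv0$ (or, more generally, $o$ arbitrary with $\int_0^t|o(s)|\,ds$ bounded). Let $(h,z)$ be a solution on $[0,\infty)$ with $z(0)=0$ that does not converge to $(-h^*,0)$. Then $(h,z)$ converges to $(h^*,0)$. If moreover $|o(t)|$ is ultimately bounded by a decaying exponential $Me^{-\lambda t}$ with $\lambda>0$, then so is $|h(t)-h^*(t)|+|z(t)|$ (with possibly other constants). -/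

import Mathlib

open Filter Topology

namespace HeadingControl

/-- Three-dimensional Euclidean space. -/
abbrev E3 : Type := EuclideanSpace ℝ (Fin 3)

/-- The cross product of Euclidean vectors. -/
noncomputable def cross (a b : E3) : E3 :=
  WithLp.toLp 2 (crossProduct (WithLp.ofLp a) (WithLp.ofLp b))

/-- Projection on the plane orthogonal to the unit vector `u`. -/
noncomputable def planeProj (u x : E3) : E3 := x - (inner ℝ u x) • u

/-- `α : [0,∞) → (0,1]` is a scalar saturation profile with level `Δ`: (strictly) decreasing, twice
differentiable on `[0,∞)`, with `α 0 = 1`, `α' 0 = 0`, `α x ≤ Δ / x` and `α x * x → Δ`.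
Values of `α` at negative numbers play no role. -/
structure IsSatProfile (Δ : ℝ) (α : ℝ → ℝ) : Prop where
  mem_Ioc : ∀ x, 0 ≤ x → α x ∈ Set.Ioc (0 : ℝ) 1
  strictAnti : StrictAntiOn α (Set.Ici 0)
  diff : DifferentiableOn ℝ α (Set.Ici 0)
  diff_two : DifferentiableOn ℝ (derivWithin α (Set.Ici 0)) (Set.Ici 0)
  at_zero : α 0 = 1
  deriv_zero : derivWithin α (Set.Ici 0) 0 = 0
  le_div : ∀ x, 0 < x → α x ≤ Δ / x
  tendsto : Tendsto (fun x => α x * x) atTop (𝓝 Δ)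

/-- The data of the controller: the gains `k_{h,1}`, `k_{h,2}`, `k_z`, the saturation level `Δ_z`,
and the saturation profile `α^{Δ_z}`. -/
structure Params where
  kh1 : ℝ
  kh2 : ℝ
  kz : ℝ
  Δz : ℝ
  α : ℝ → ℝ

/-- The gains and the saturation level are positive and `α` is a saturation profile. -/
structure Params.Admissible (P : Params) : Prop where
  kh1_pos : 0 < P.kh1
  kh2_pos : 0 < P.kh2
  kz_pos : 0 < P.kz
  Δz_pos : 0 < P.Δz
  profile : IsSatProfile P.Δz P.α

/-- The smooth vector saturation `α(|y|) y`. -/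
noncomputable def Params.sat (P : Params) (y : E3) : E3 := P.α ‖y‖ • y

/-- A desired heading: a differentiable curve of unit vectors, defined for all times `t ≥ 0`. -/
structure IsReference (hs : ℝ → E3) : Prop where
  norm_eq_one : ∀ t, 0 ≤ t → ‖hs t‖ = 1
  diff : DifferentiableOn ℝ hs (Set.Ici 0)

/-- The angular velocity `h* × dh*/dt` of the desired heading. -/
noncomputable def omegaRef (hs : ℝ → E3) (t : ℝ) : E3 :=
  cross (hs t) (derivWithin hs (Set.Ici 0) t)

/-- The scalar gain `α_h = α(|z + h̃ / k_z|)`, where `h̃ = h × h*`. -/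
noncomputable def Params.alphaH (P : Params) (htilde z : E3) : ℝ :=
  P.α ‖z + P.kz⁻¹ • htilde‖

/-- The desired angular velocity `ω_{h*} + k_{h,1} h̃ + k_{h,2} α_h z` of the heading, at time `t`
and in the state `(h, z)`. -/
noncomputable def Params.omegaBar (P : Params) (hs : ℝ → E3) (t : ℝ) (h z : E3) : E3 :=
  omegaRef hs t + P.kh1 • cross h (hs t) + (P.kh2 * P.alphaH (cross h (hs t)) z) • z

/-- The actual angular velocity `ω_h = Π_h ω̄_h + o` of the heading. -/
noncomputable def Params.omegaH (P : Params) (hs o : ℝ → E3) (t : ℝ) (h z : E3) : E3 :=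
  planeProj h (P.omegaBar hs t h z) + o t

/-- The right-hand side of the equation of the bounded integral term `z`. -/
noncomputable def Params.zRate (P : Params) (hs : ℝ → E3) (t : ℝ) (h z : E3) : E3 :=
  cross (omegaRef hs t) z + P.kz • (-z + P.sat (z + P.kz⁻¹ • cross h (hs t)))

/-- `(h, z)` solves `dh/dt = ω_h × h` and the equation of the integral term on `[t₀, ∞)`, `h` being
a curve of unit vectors. The initial condition on `z` is not included. -/
structure Params.IsSolution (P : Params) (hs o : ℝ → E3) (t₀ : ℝ) (h z : ℝ → E3) : Prop where
  norm_eq_one : ∀ t, t₀ ≤ t → ‖h t‖ = 1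
  heading : ∀ t, t₀ ≤ t →
    HasDerivWithinAt h (cross (P.omegaH hs o t (h t) (z t)) (h t)) (Set.Ici t₀) t
  integrator : ∀ t, t₀ ≤ t →
    HasDerivWithinAt z (P.zRate hs t (h t) (z t)) (Set.Ici t₀) t

/-- Distance between `(h, z)` and `(e, 0)` at time `t`. -/
noncomputable def err (e h z : ℝ → E3) (t : ℝ) : ℝ := ‖h t - e t‖ + ‖z t‖

/-- `(h, z)` converges to `(e, 0)`. -/
def ConvergesTo (e h z : ℝ → E3) : Prop := Tendsto (err e h z) atTop (𝓝 0)

/-- `(h, z)` is an equilibrium of the residual-free system: it is a solution on `[0, ∞)` for which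
both `h` and `z` are at rest with respect to a frame rotating with the angular velocity `ω_{h*}`
of the desired heading. -/
structure Params.IsEquilibrium (P : Params) (hs h z : ℝ → E3) : Prop where
  isSolution : P.IsSolution hs (fun _ => 0) 0 h z
  heading_at_rest : ∀ t, 0 ≤ t →
    HasDerivWithinAt h (cross (omegaRef hs t) (h t)) (Set.Ici 0) t
  integrator_at_rest : ∀ t, 0 ≤ t →
    HasDerivWithinAt z (cross (omegaRef hs t) (z t)) (Set.Ici 0) t

/-- Local exponential stability of `(e, 0)` for the residual-free system, uniform in the initial
time, with radius `δ`, overshoot `K` and rate `lam`. The states considered at the initial time are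
those with `z` orthogonal to `h*`; since `z(0) = 0` and orthogonality of `z` and `h*` is preserved
by the system, these include all the states that the system can reach. -/
def Params.ExpStableWith (P : Params) (δ K lam : ℝ) (hs e : ℝ → E3) : Prop :=
  ∀ t₀, 0 ≤ t₀ → ∀ h z : ℝ → E3, P.IsSolution hs (fun _ => 0) t₀ h z →
    inner ℝ (z t₀) (hs t₀) = 0 → err e h z t₀ < δ →
    ∀ t, t₀ ≤ t → err e h z t ≤ K * Real.exp (-lam * (t - t₀)) * err e h z t₀

/-- Instability (from every initial time) of `(e, 0)` for the residual-free system: there are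
solutions that start with `z = 0` and `h` arbitrarily close to `e`, and nevertheless leave a fixed
neighbourhood of `(e, 0)`. -/
def Params.Unstable (P : Params) (hs e : ℝ → E3) : Prop :=
  ∀ t₀, 0 ≤ t₀ → ∃ ε, 0 < ε ∧ ∀ δ, 0 < δ → ∃ h z : ℝ → E3,
    P.IsSolution hs (fun _ => 0) t₀ h z ∧ z t₀ = 0 ∧ ‖h t₀ - e t₀‖ < δ ∧
    ∃ t, t₀ ≤ t ∧ ε ≤ err e h z t

/-- The integrals of `|o|` over `[0, t]` exist and are bounded. -/
def BoundedIntegral (o : ℝ → E3) : Prop :=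
  (∀ t, 0 ≤ t → IntervalIntegrable o MeasureTheory.volume 0 t) ∧
    ∃ C : ℝ, ∀ t, 0 ≤ t → (∫ s in (0 : ℝ)..t, ‖o s‖) ≤ C

/-- `f` is ultimately bounded by a decaying exponential. -/
def UltimatelyExp (f : ℝ → ℝ) : Prop :=
  ∃ M lam T : ℝ, 0 < lam ∧ ∀ t, T ≤ t → f t ≤ M * Real.exp (-lam * t)

end HeadingControl

open scoped InnerProductSpace

namespace HeadingControl

/-! ### The cross product of Euclidean vectors -/

/-! The common rotation `ω_{h*}` preserves inner products, so the argument runs on the scalars `c =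
h·h*`, `|z|²` and `h̃·z`, with `|h̃|² = 1 - c²`. The energy `V = 1 - c + k_{h,2}|z|²/2` has
derivative `-k_{h,1}|h̃|² - k_{h,2}k_z(1-α_h)|z|² - o·h̃`; the weight of `|z|²` cancels the
indefinite terms `h̃·z`.

Convergence. Since `o` is integrable, so is the dissipation, and `V` has a limit. Integrability of
`1 - c²` forces `c² → 1` (`tendsto_inner_sq`), so `c → 1` or `c → -1` by continuity. Then `|z|` has
a limit, and integrability of the dissipation leaves only the limit `0`, because `α < 1` away from
`0` (`tendsto_integrator`). So each solution converges to `(h*, 0)` or `(-h*, 0)`. If `o = 0`, then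
`V` is nonincreasing, and `V < 2` initially excludes `(-h*, 0)`, whose energy is `2`.

Rates. The dissipation degenerates in `z`, because `1 - α_h` vanishes at `(h*, 0)`. Adding `ε h̃·z`
to `V` supplies a term `-ε c k_{h,2} α_h |z|²` and, for small `ε`, gives a strict Lyapunov function
(`exists_strict_lyapunov`). Both exponential statements follow from it by a Gronwall argument.

Instability. Headings near `-h*` but different from it, with `z = 0`, have energy below `2`, so
their solutions go to `h*`. What remains is that such solutions exist: the field is `C¹` because
`α'(0) = 0`, and a priori bounds exclude blow-up. -/

lemma inner_eq_sum (a b : E3) : ⟪a, b⟫_ℝ = a 0 * b 0 + a 1 * b 1 + a 2 * b 2 := by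
  simp [PiLp.inner_apply, Fin.sum_univ_three, mul_comm]

lemma cross_apply_zero (a b : E3) : cross a b 0 = a 1 * b 2 - a 2 * b 1 := by
  simp [cross, crossProduct]

lemma cross_apply_one (a b : E3) : cross a b 1 = a 2 * b 0 - a 0 * b 2 := by
  simp [cross, crossProduct]

lemma cross_apply_two (a b : E3) : cross a b 2 = a 0 * b 1 - a 1 * b 0 := by
  simp [cross, crossProduct]

lemma ext_three {a b : E3} (h0 : a 0 = b 0) (h1 : a 1 = b 1) (h2 : a 2 = b 2) : a = b := by
  ext i; fin_cases i <;> assumption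

lemma cross_add_left (a b c : E3) : cross (a + b) c = cross a c + cross b c := by
  simp [cross]

lemma cross_add_right (a b c : E3) : cross a (b + c) = cross a b + cross a c := by
  simp [cross]

lemma cross_smul_left (r : ℝ) (a b : E3) : cross (r • a) b = r • cross a b := by
  simp [cross]

lemma cross_smul_right (r : ℝ) (a b : E3) : cross a (r • b) = r • cross a b := by
  simp [cross]

lemma cross_self (a : E3) : cross a a = 0 := by
  simp [cross]

lemma cross_zero_right (a : E3) : cross a 0 = 0 := by
  simp [cross]

lemma cross_zero_left (a : E3) : cross 0 a = 0 := by
  simp [cross]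

lemma cross_neg_left (a b : E3) : cross (-a) b = -cross a b := by
  simpa using cross_smul_left (-1) a b

lemma inner_cross_self_left (a b : E3) : ⟪cross a b, a⟫_ℝ = 0 := by
  simp only [inner_eq_sum, cross_apply_zero, cross_apply_one, cross_apply_two]; ring

lemma inner_cross_self_right (a b : E3) : ⟪cross a b, b⟫_ℝ = 0 := by
  simp only [inner_eq_sum, cross_apply_zero, cross_apply_one, cross_apply_two]; ring

/-- Cyclic invariance of the triple product. -/
lemma inner_cross_cyclic (a b c : E3) : ⟪cross a b, c⟫_ℝ = ⟪a, cross b c⟫_ℝ := by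
  simp only [inner_eq_sum, cross_apply_zero, cross_apply_one, cross_apply_two]; ring

/-- A common rotation preserves the inner product. -/
lemma inner_cross_add_inner_cross (w a b : E3) : ⟪cross w a, b⟫_ℝ + ⟪a, cross w b⟫_ℝ = 0 := by
  simp only [inner_eq_sum, cross_apply_zero, cross_apply_one, cross_apply_two]; ring

/-- The Jacobi identity. -/
lemma cross_cross_add_cross_cross (w a b : E3) :
    cross (cross w a) b + cross a (cross w b) = cross w (cross a b) := by
  apply ext_three <;>
  simp only [PiLp.add_apply, cross_apply_zero, cross_apply_one, cross_apply_two] <;> ring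

lemma cross_cross_left (a b c : E3) : cross (cross a b) c = ⟪a, c⟫_ℝ • b - ⟪b, c⟫_ℝ • a := by
  apply ext_three <;>
  simp only [PiLp.sub_apply, PiLp.smul_apply, smul_eq_mul, inner_eq_sum, cross_apply_zero,
    cross_apply_one, cross_apply_two] <;> ring

/-- The Lagrange identity. -/
lemma norm_cross_sq (a b : E3) : ‖cross a b‖ ^ 2 = ‖a‖ ^ 2 * ‖b‖ ^ 2 - ⟪a, b⟫_ℝ ^ 2 := by
  simp only [← real_inner_self_eq_norm_sq, inner_eq_sum, cross_apply_zero, cross_apply_one,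
    cross_apply_two]
  ring

lemma norm_cross_le (a b : E3) : ‖cross a b‖ ≤ ‖a‖ * ‖b‖ := by
  refine le_of_sq_le_sq ?_ (by positivity)
  rw [norm_cross_sq, mul_pow]
  nlinarith [sq_nonneg ⟪a, b⟫_ℝ]

lemma cross_planeProj (h x : E3) : cross (planeProj h x) h = cross x h := by
  rw [planeProj, sub_eq_add_neg, cross_add_left, ← neg_smul, cross_smul_left, cross_self]
  simp

/-- The cross product as a continuous bilinear map. -/
noncomputable def crossL : E3 →L[ℝ] E3 →L[ℝ] E3 :=
  (LinearMap.mk₂ ℝ cross cross_add_left cross_smul_left cross_add_right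
    cross_smul_right).mkContinuous₂ 1 fun a b => by simpa using norm_cross_le a b

lemma _root_.HasDerivWithinAt.cross {a b : ℝ → E3} {a' b' : E3} {s : Set ℝ} {t : ℝ}
    (ha : HasDerivWithinAt a a' s t) (hb : HasDerivWithinAt b b' s t) :
    HasDerivWithinAt (fun t => cross (a t) (b t)) (cross a' (b t) + cross (a t) b') s t := by
  have := crossL.hasDerivWithinAt_of_bilinear ha hb
  rw [add_comm]
  exact this

lemma _root_.ContinuousOn.cross {X : Type*} [TopologicalSpace X] {a b : X → E3} {s : Set X}
    (ha : ContinuousOn a s) (hb : ContinuousOn b s) :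
    ContinuousOn (fun t => cross (a t) (b t)) s :=
  crossL.continuous₂.comp_continuousOn (ha.prodMk hb)

lemma _root_.ContDiff.cross {X : Type*} [NormedAddCommGroup X] [NormedSpace ℝ X] {n : WithTop ℕ∞}
    {a b : X → E3} (ha : ContDiff ℝ n a) (hb : ContDiff ℝ n b) :
    ContDiff ℝ n (fun t => cross (a t) (b t)) :=
  crossL.isBoundedBilinearMap.contDiff.comp (ha.prodMk hb)

/-! ### The reference and the evolution of the scalar invariants -/

lemma IsReference.inner_derivWithin {hs : ℝ → E3} (H : IsReference hs) {t : ℝ} (ht : 0 ≤ t) :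
    ⟪hs t, derivWithin hs (Set.Ici 0) t⟫_ℝ = 0 := by
  have h1 := (H.diff t ht).hasDerivWithinAt
  have h2 := h1.inner ℝ h1
  have h3 : HasDerivWithinAt (fun t => ⟪hs t, hs t⟫_ℝ) 0 (Set.Ici 0) t :=
    (hasDerivWithinAt_const t (Set.Ici 0) (1 : ℝ)).congr
      (fun x hx => by rw [real_inner_self_eq_norm_sq, H.norm_eq_one x hx]; norm_num)
      (by rw [real_inner_self_eq_norm_sq, H.norm_eq_one t ht]; norm_num)
  have := (uniqueDiffOn_Ici (0 : ℝ) t ht).eq_deriv _ h2 h3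
  rw [real_inner_comm (hs t)] at this
  have h4 := real_inner_comm (derivWithin hs (Set.Ici 0) t) (hs t)
  linarith

/-- The velocity of a unit vector is orthogonal to it, so `(h* × ḣ*) × h* = ḣ*`. -/
lemma IsReference.hasDerivWithinAt {hs : ℝ → E3} (H : IsReference hs) {t : ℝ} (ht : 0 ≤ t) :
    HasDerivWithinAt hs (cross (omegaRef hs t) (hs t)) (Set.Ici 0) t := by
  have h1 := (H.diff t ht).hasDerivWithinAt
  have : cross (omegaRef hs t) (hs t) = derivWithin hs (Set.Ici 0) t := by
    rw [omegaRef, cross_cross_left, real_inner_self_eq_norm_sq, H.norm_eq_one t ht,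
      real_inner_comm, H.inner_derivWithin ht]
    simp
  rwa [this]

/-- The part of the angular velocity of the heading that is due to the feedback and the residual. -/
noncomputable def Params.feedback (P : Params) (k o h z : E3) : E3 :=
  P.kh1 • cross h k + (P.kh2 * P.alphaH (cross h k) z) • z + o

/-- The projection may be dropped, since angular velocity along `h` does not move `h`. What remains
beside the common rotation is the feedback. -/
lemma Params.cross_omegaH (P : Params) (hs o : ℝ → E3) (t : ℝ) (h z : E3) :
    cross (P.omegaH hs o t h z) h
      = cross (omegaRef hs t) h + cross (P.feedback (hs t) (o t) h z) h := by
  rw [omegaH, cross_add_left, cross_planeProj, omegaBar, feedback]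
  simp only [cross_add_left]
  abel

/-- Splitting the saturation exhibits a leak of rate `k_z(1-α_h)` and a drive `α_h h̃`. -/
lemma Params.zRate_eq (P : Params) (hk : P.kz ≠ 0) (hs : ℝ → E3) (t : ℝ) (h z : E3) :
    P.zRate hs t h z = cross (omegaRef hs t) z
      - (P.kz * (1 - P.alphaH (cross h (hs t)) z)) • z
      + P.alphaH (cross h (hs t)) z • cross h (hs t) := by
  rw [zRate, sat, ← alphaH]
  set a := P.alphaH (cross h (hs t)) z
  have : P.kz • P.kz⁻¹ • cross h (hs t) = cross h (hs t) := by
    rw [smul_smul, mul_inv_cancel₀ hk, one_smul]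
  calc _ = cross (omegaRef hs t) z - (P.kz * (1 - a)) • z
      + a • (P.kz • P.kz⁻¹ • cross h (hs t)) := by module
    _ = _ := by rw [this]

lemma Params.Admissible.alphaH_mem {P : Params} (hP : P.Admissible) (k z : E3) :
    P.alphaH k z ∈ Set.Ioc (0 : ℝ) 1 :=
  hP.profile.mem_Ioc _ (norm_nonneg _)

section Evolution

variable {P : Params} {hs o h z : ℝ → E3} {t₀ t : ℝ}

lemma IsReference.hasDerivWithinAt_Ici (H : IsReference hs) (h0 : 0 ≤ t₀) (ht : t₀ ≤ t) :
    HasDerivWithinAt hs (cross (omegaRef hs t) (hs t)) (Set.Ici t₀) t :=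
  (H.hasDerivWithinAt (h0.trans ht)).mono (Set.Ici_subset_Ici.2 h0)

lemma IsReference.continuousOn (H : IsReference hs) (h0 : 0 ≤ t₀) :
    ContinuousOn hs (Set.Ici t₀) :=
  fun _ ht => (H.hasDerivWithinAt_Ici h0 ht).continuousWithinAt

lemma Params.IsSolution.continuousOn_heading (S : P.IsSolution hs o t₀ h z) :
    ContinuousOn h (Set.Ici t₀) :=
  fun t ht => (S.heading t ht).continuousWithinAt

lemma Params.IsSolution.continuousOn_integrator (S : P.IsSolution hs o t₀ h z) :
    ContinuousOn z (Set.Ici t₀) :=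
  fun t ht => (S.integrator t ht).continuousWithinAt

lemma Params.IsSolution.continuousOn_cross (S : P.IsSolution hs o t₀ h z) (H : IsReference hs)
    (h0 : 0 ≤ t₀) : ContinuousOn (fun t => cross (h t) (hs t)) (Set.Ici t₀) :=
  S.continuousOn_heading.cross (H.continuousOn h0)

lemma Params.IsSolution.continuousOn_alphaH (hP : P.Admissible) (S : P.IsSolution hs o t₀ h z)
    (H : IsReference hs) (h0 : 0 ≤ t₀) :
    ContinuousOn (fun t => P.alphaH (cross (h t) (hs t)) (z t)) (Set.Ici t₀) := by
  have h1 : ContinuousOn (fun t => ‖z t + P.kz⁻¹ • cross (h t) (hs t)‖) (Set.Ici t₀) := by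
    have hz := S.continuousOn_integrator
    have hc := S.continuousOn_cross H h0
    fun_prop
  exact hP.profile.diff.continuousOn.comp h1 fun _ _ => norm_nonneg _

lemma Params.IsSolution.hasDerivWithinAt_inner (S : P.IsSolution hs o t₀ h z) (H : IsReference hs)
    (h0 : 0 ≤ t₀) (ht : t₀ ≤ t) :
    HasDerivWithinAt (fun t => ⟪h t, hs t⟫_ℝ)
      (P.kh1 * ‖cross (h t) (hs t)‖ ^ 2
        + P.kh2 * P.alphaH (cross (h t) (hs t)) (z t) * ⟪cross (h t) (hs t), z t⟫_ℝ
        + ⟪o t, cross (h t) (hs t)⟫_ℝ) (Set.Ici t₀) t := by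
  refine ((S.heading t ht).inner ℝ (H.hasDerivWithinAt_Ici h0 ht)).congr_deriv ?_
  rw [P.cross_omegaH, inner_add_left, inner_cross_cyclic (P.feedback _ _ _ _), feedback,
    inner_add_left, inner_add_left, real_inner_smul_left, real_inner_smul_left,
    real_inner_self_eq_norm_sq, real_inner_comm (z t)]
  linarith [inner_cross_add_inner_cross (omegaRef hs t) (h t) (hs t)]

lemma Params.IsSolution.hasDerivWithinAt_norm_sq (hP : P.Admissible)
    (S : P.IsSolution hs o t₀ h z) (ht : t₀ ≤ t) :
    HasDerivWithinAt (fun t => ‖z t‖ ^ 2)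
      (2 * (-(P.kz * (1 - P.alphaH (cross (h t) (hs t)) (z t))) * ‖z t‖ ^ 2
        + P.alphaH (cross (h t) (hs t)) (z t) * ⟪cross (h t) (hs t), z t⟫_ℝ)) (Set.Ici t₀) t := by
  refine (S.integrator t ht).norm_sq.congr_deriv ?_
  rw [P.zRate_eq hP.kz_pos.ne', inner_add_right, inner_sub_right, real_inner_smul_right,
    real_inner_smul_right, real_inner_self_eq_norm_sq, real_inner_comm (cross _ _) (z t),
    inner_cross_self_right, real_inner_comm]
  ring

lemma Params.IsSolution.hasDerivWithinAt_inner_integrator (hP : P.Admissible)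
    (S : P.IsSolution hs o t₀ h z) (H : IsReference hs) (h0 : 0 ≤ t₀) (ht : t₀ ≤ t) :
    HasDerivWithinAt (fun t => ⟪z t, hs t⟫_ℝ)
      (-(P.kz * (1 - P.alphaH (cross (h t) (hs t)) (z t))) * ⟪z t, hs t⟫_ℝ) (Set.Ici t₀) t := by
  refine ((S.integrator t ht).inner ℝ (H.hasDerivWithinAt_Ici h0 ht)).congr_deriv ?_
  rw [P.zRate_eq hP.kz_pos.ne', inner_add_left, inner_sub_left, real_inner_smul_left,
    real_inner_smul_left, inner_cross_self_right]
  linarith [inner_cross_add_inner_cross (omegaRef hs t) (z t) (hs t)]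

lemma antitoneOn_Ici_of_hasDerivWithinAt_nonpos {f f' : ℝ → ℝ} {a : ℝ}
    (hf : ∀ t, a ≤ t → HasDerivWithinAt f (f' t) (Set.Ici a) t) (hf' : ∀ t, a ≤ t → f' t ≤ 0) :
    AntitoneOn f (Set.Ici a) := by
  refine antitoneOn_of_hasDerivWithinAt_nonpos (f' := f') (convex_Ici a)
    (fun t ht => (hf t ht).continuousWithinAt) (fun t ht => ?_) fun t ht => ?_
  · exact (hf t (interior_subset ht)).mono interior_subset
  · exact hf' t (interior_subset ht)

/-- Orthogonality of the integral term and the reference is preserved. -/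
lemma Params.IsSolution.inner_integrator_eq_zero (hP : P.Admissible)
    (S : P.IsSolution hs o t₀ h z) (H : IsReference hs) (h0 : 0 ≤ t₀)
    (hz : ⟪z t₀, hs t₀⟫_ℝ = 0) (ht : t₀ ≤ t) : ⟪z t, hs t⟫_ℝ = 0 := by
  -- The leak makes `(z·h*)²` nonincreasing, and it starts at zero.
  have hanti := antitoneOn_Ici_of_hasDerivWithinAt_nonpos
    (fun t ht => (S.hasDerivWithinAt_inner_integrator hP H h0 ht).pow 2) fun t ht => by
      have := (hP.alphaH_mem (cross (h t) (hs t)) (z t)).2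
      have h2 := mul_nonneg (mul_nonneg hP.kz_pos.le (sub_nonneg.2 this)) (sq_nonneg ⟪z t, hs t⟫_ℝ)
      simp only [Nat.cast_ofNat, Nat.add_one_sub_one, pow_one]
      nlinarith
  have := hanti Set.self_mem_Ici ht ht
  simp only [hz, Pi.pow_apply] at this
  have h3 : ⟪z t, hs t⟫_ℝ ^ 2 ≤ 0 := by simpa using this
  exact pow_eq_zero_iff two_ne_zero |>.1 (le_antisymm h3 (sq_nonneg _))

/-- This is the cross term of the strict Lyapunov function; its value lies in the damping `-c
k_{h,2} α_h |z|²`. Orthogonality of `z` and `h*` removes the product of `z·h*` and `h·z`. -/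
lemma Params.IsSolution.hasDerivWithinAt_inner_cross (hP : P.Admissible)
    (S : P.IsSolution hs o t₀ h z) (H : IsReference hs) (h0 : 0 ≤ t₀)
    (hz : ⟪z t₀, hs t₀⟫_ℝ = 0) (ht : t₀ ≤ t) :
    HasDerivWithinAt (fun t => ⟪cross (h t) (hs t), z t⟫_ℝ)
      (-((⟪h t, hs t⟫_ℝ * P.kh1 + P.kz * (1 - P.alphaH (cross (h t) (hs t)) (z t)))
            * ⟪cross (h t) (hs t), z t⟫_ℝ)
          - ⟪h t, hs t⟫_ℝ * P.kh2 * P.alphaH (cross (h t) (hs t)) (z t) * ‖z t‖ ^ 2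
          + P.alphaH (cross (h t) (hs t)) (z t) * ‖cross (h t) (hs t)‖ ^ 2
          + (⟪o t, hs t⟫_ℝ * ⟪h t, z t⟫_ℝ - ⟪h t, hs t⟫_ℝ * ⟪o t, z t⟫_ℝ)) (Set.Ici t₀) t := by
  refine (((S.heading t ht).cross (H.hasDerivWithinAt_Ici h0 ht)).inner ℝ
    (S.integrator t ht)).congr_deriv ?_
  have hz' := S.inner_integrator_eq_zero hP H h0 hz ht
  rw [P.cross_omegaH, P.zRate_eq hP.kz_pos.ne', cross_add_left, add_right_comm,
    cross_cross_add_cross_cross, cross_cross_left (P.feedback _ _ _ _)]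
  have e := inner_cross_add_inner_cross (omegaRef hs t) (cross (h t) (hs t)) (z t)
  have e1 : ⟪P.feedback (hs t) (o t) (h t) (z t), hs t⟫_ℝ = ⟪o t, hs t⟫_ℝ := by
    rw [feedback, inner_add_left, inner_add_left, real_inner_smul_left, real_inner_smul_left,
      hz', inner_cross_self_right]
    ring
  have e2 : ⟪P.feedback (hs t) (o t) (h t) (z t), z t⟫_ℝ
      = P.kh1 * ⟪cross (h t) (hs t), z t⟫_ℝ
        + P.kh2 * P.alphaH (cross (h t) (hs t)) (z t) * ‖z t‖ ^ 2 + ⟪o t, z t⟫_ℝ := by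
    rw [feedback, inner_add_left, inner_add_left, real_inner_smul_left, real_inner_smul_left,
      real_inner_self_eq_norm_sq]
  simp only [inner_add_left, inner_sub_left, inner_add_right, inner_sub_right,
    real_inner_smul_left, real_inner_smul_right, e1, e2, real_inner_self_eq_norm_sq]
  linear_combination e

end Evolution

/-! ### Integrable dissipation and limits at infinity -/

open MeasureTheory Set in
/-- A nonnegative function that decreases at rate `g ≥ 0`, up to an integrable error, has a limit and is
bounded, and `g` is integrable. -/
lemma integrableOn_Ioi_and_exists_tendsto {f g e : ℝ → ℝ} {a : ℝ}
    (hf : ∀ t, a ≤ t → HasDerivWithinAt f (-g t + e t) (Ici a) t) (hf0 : ∀ t, a ≤ t → 0 ≤ f t)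
    (hg : ContinuousOn g (Ici a)) (hg0 : ∀ t, a ≤ t → 0 ≤ g t) (he : IntegrableOn e (Ioi a)) :
    IntegrableOn g (Ioi a) ∧ (∃ l, Tendsto f atTop (𝓝 l)) ∧ ∃ C, ∀ t, a ≤ t → f t ≤ C := by
  have hgi : ∀ t, a ≤ t → IntervalIntegrable g volume a t := fun t ht =>
    (hg.mono Icc_subset_Ici_self).intervalIntegrable_of_Icc ht
  have hei : ∀ t, a ≤ t → IntervalIntegrable e volume a t := fun t ht =>
    (intervalIntegrable_iff_integrableOn_Ioc_of_le ht).2 (he.mono_set Ioc_subset_Ioi_self)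
  -- The fundamental theorem of calculus bounds the accumulated decrease by the initial value plus
  -- the total error.
  have hbd : ∀ t, a ≤ t → f t + ∫ s in a..t, g s ≤ f a + ∫ t in Ioi a, ‖e t‖ := fun t ht => by
    have h2 : ∫ s in a..t, (-g s + e s) = f t - f a :=
      intervalIntegral.integral_eq_sub_of_hasDeriv_right_of_le ht
        (fun s hs => ((hf s hs.1).continuousWithinAt).mono Icc_subset_Ici_self)
        (fun s hs => (hf s hs.1.le).mono fun x hx => hs.1.le.trans (le_of_lt hx))
        ((hgi t ht).neg.add (hei t ht))
    rw [intervalIntegral.integral_add (f := fun s => -g s) (hgi t ht).neg (hei t ht),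
      intervalIntegral.integral_neg] at h2
    have h3 : ∫ s in a..t, e s ≤ ∫ s in Ioi a, ‖e s‖ := by
      calc _ ≤ ‖∫ s in a..t, e s‖ := le_abs_self _
        _ ≤ ∫ s in a..t, ‖e s‖ := intervalIntegral.norm_integral_le_integral_norm ht
        _ = ∫ s in Ioc a t, ‖e s‖ := intervalIntegral.integral_of_le ht
        _ ≤ _ := setIntegral_mono_set he.norm (ae_of_all _ fun _ => norm_nonneg _)
          (ae_of_all _ Ioc_subset_Ioi_self)
    linarith
  have hint : IntegrableOn g (Ioi a) := by
    refine integrableOn_Ioi_of_intervalIntegral_norm_bounded (f a + ∫ t in Ioi a, ‖e t‖) a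
      (b := id) (l := atTop) (fun t => ?_) tendsto_id ?_
    · exact ((hg.mono Icc_subset_Ici_self).integrableOn_Icc).mono_set Ioc_subset_Icc_self
    · filter_upwards [eventually_ge_atTop a] with t ht
      have h1 : ∫ s in a..t, ‖g s‖ = ∫ s in a..t, g s := by
        refine intervalIntegral.integral_congr fun s hs => ?_
        rw [uIcc_of_le ht] at hs
        exact (Real.norm_eq_abs _).trans (abs_of_nonneg (hg0 s hs.1))
      simp only [id, h1]
      linarith [hf0 t ht, hbd t ht]
  refine ⟨hint, ⟨_, tendsto_limUnder_of_hasDerivAt_of_integrableOn_Ioi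
    (fun t ht => (hf t (le_of_lt ht)).hasDerivAt (Ici_mem_nhds ht)) (hint.neg.add he)⟩,
    f a + ∫ t in Ioi a, ‖e t‖, fun t ht => ?_⟩
  have := intervalIntegral.integral_nonneg (μ := volume) ht fun s hs => hg0 s hs.1
  linarith [hbd t ht]

/-- A positive limit would keep `f` above a positive constant on a half-line of infinite measure. -/
lemma tendsto_eq_zero_of_integrableOn_Ioi {f : ℝ → ℝ} {a l : ℝ} (hf : ∀ t, a ≤ t → 0 ≤ f t)
    (hi : MeasureTheory.IntegrableOn f (Set.Ioi a)) (hl : Tendsto f atTop (𝓝 l)) : l = 0 := by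
  by_contra hne
  have h0 : 0 ≤ l := ge_of_tendsto hl <| by filter_upwards [eventually_ge_atTop a] with t ht using hf t ht
  have hpos : 0 < l := lt_of_le_of_ne h0 (Ne.symm hne)
  obtain ⟨b, hb⟩ := eventually_atTop.1 (hl.eventually_const_lt (half_lt_self hpos))
  have h1 : MeasureTheory.IntegrableOn (fun _ : ℝ => l / 2) (Set.Ioi (max a b)) := by
    refine (hi.mono_set (Set.Ioi_subset_Ioi (le_max_left a b))).mono'
      MeasureTheory.aestronglyMeasurable_const ?_
    refine (MeasureTheory.ae_restrict_iff' measurableSet_Ioi).2 (MeasureTheory.ae_of_all _ fun t ht => ?_)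
    rw [Real.norm_of_nonneg (half_pos hpos).le]
    exact (hb t ((le_max_right a b).trans (le_of_lt ht))).le
  rw [MeasureTheory.integrableOn_const_iff] at h1
  simp [hpos.ne'] at h1

/-! ### Chords and angles of unit vectors -/

section Geometry

variable {h k : E3}

lemma norm_cross_sq_of_unit (hh : ‖h‖ = 1) (hk : ‖k‖ = 1) : ‖cross h k‖ ^ 2 = 1 - ⟪h, k⟫_ℝ ^ 2 := by
  rw [norm_cross_sq, hh, hk]; ring

lemma norm_cross_le_one (hh : ‖h‖ = 1) (hk : ‖k‖ = 1) : ‖cross h k‖ ≤ 1 := by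
  simpa [hh, hk] using norm_cross_le h k

lemma abs_inner_le_one (hh : ‖h‖ = 1) (hk : ‖k‖ = 1) : |⟪h, k⟫_ℝ| ≤ 1 := by
  simpa [hh, hk] using abs_real_inner_le_norm h k

lemma norm_sub_sq_of_unit (hh : ‖h‖ = 1) (hk : ‖k‖ = 1) : ‖h - k‖ ^ 2 = 2 * (1 - ⟪h, k⟫_ℝ) := by
  rw [norm_sub_sq_real, hh, hk]; ring

lemma norm_add_sq_of_unit (hh : ‖h‖ = 1) (hk : ‖k‖ = 1) :
    ‖h - -k‖ ^ 2 = 2 * (1 + ⟪h, k⟫_ℝ) := by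
  rw [norm_sub_sq_real, norm_neg, hh, hk, inner_neg_right]; ring

end Geometry

/-! ### The energy and convergence to one of the two equilibria -/

section Convergence

variable {P : Params} {hs o h z : ℝ → E3} {t₀ t : ℝ}

/-- The Lyapunov function. -/
noncomputable def Params.energy (P : Params) (hs h z : ℝ → E3) (t : ℝ) : ℝ :=
  1 - ⟪h t, hs t⟫_ℝ + P.kh2 / 2 * ‖z t‖ ^ 2

/-- The rate of decrease of the Lyapunov function. -/
noncomputable def Params.dissipation (P : Params) (hs h z : ℝ → E3) (t : ℝ) : ℝ :=
  P.kh1 * ‖cross (h t) (hs t)‖ ^ 2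
    + P.kh2 * (P.kz * (1 - P.alphaH (cross (h t) (hs t)) (z t))) * ‖z t‖ ^ 2

lemma Params.IsSolution.hasDerivWithinAt_energy (hP : P.Admissible)
    (S : P.IsSolution hs o t₀ h z) (H : IsReference hs) (h0 : 0 ≤ t₀) (ht : t₀ ≤ t) :
    HasDerivWithinAt (P.energy hs h z)
      (-P.dissipation hs h z t + -⟪o t, cross (h t) (hs t)⟫_ℝ) (Set.Ici t₀) t := by
  refine (((S.hasDerivWithinAt_inner H h0 ht).const_sub 1).add
    ((S.hasDerivWithinAt_norm_sq hP ht).const_mul (P.kh2 / 2))).congr_deriv ?_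
  rw [dissipation]; ring

lemma Params.Admissible.dissipation_nonneg (hP : P.Admissible) (hs h z : ℝ → E3) (t : ℝ) :
    0 ≤ P.dissipation hs h z t := by
  have := sub_nonneg.2 (hP.alphaH_mem (cross (h t) (hs t)) (z t)).2
  have := hP.kh1_pos
  have := hP.kh2_pos
  have := hP.kz_pos
  unfold dissipation
  positivity

lemma Params.IsSolution.energy_nonneg (hP : P.Admissible) (S : P.IsSolution hs o t₀ h z)
    (H : IsReference hs) (h0 : 0 ≤ t₀) (ht : t₀ ≤ t) : 0 ≤ P.energy hs h z t := by
  have := (abs_le.1 (abs_inner_le_one (S.norm_eq_one t ht) (H.norm_eq_one t (h0.trans ht)))).2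
  have := mul_nonneg (half_pos hP.kh2_pos).le (sq_nonneg ‖z t‖)
  unfold energy
  linarith

lemma Params.IsSolution.energy_antitoneOn (hP : P.Admissible)
    (S : P.IsSolution hs (fun _ => 0) t₀ h z) (H : IsReference hs) (h0 : 0 ≤ t₀) :
    AntitoneOn (P.energy hs h z) (Set.Ici t₀) :=
  antitoneOn_Ici_of_hasDerivWithinAt_nonpos (fun _ ht => S.hasDerivWithinAt_energy hP H h0 ht)
    fun t _ => by simpa using hP.dissipation_nonneg hs h z t

lemma Params.IsSolution.continuousOn_inner (S : P.IsSolution hs o t₀ h z) (H : IsReference hs)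
    (h0 : 0 ≤ t₀) : ContinuousOn (fun t => ⟪h t, hs t⟫_ℝ) (Set.Ici t₀) :=
  S.continuousOn_heading.inner (𝕜 := ℝ) (H.continuousOn h0)

lemma Params.IsSolution.integrableOn_inner_residual (S : P.IsSolution hs o t₀ h z)
    (H : IsReference hs) (h0 : 0 ≤ t₀) (ho : MeasureTheory.IntegrableOn o (Set.Ioi t₀)) :
    MeasureTheory.IntegrableOn (fun t => ⟪o t, cross (h t) (hs t)⟫_ℝ) (Set.Ioi t₀) := by
  refine ho.norm.mono' (ho.aestronglyMeasurable.inner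
    (((S.continuousOn_cross H h0).mono Set.Ioi_subset_Ici_self).aestronglyMeasurable
      measurableSet_Ioi)) ?_
  refine (MeasureTheory.ae_restrict_iff' measurableSet_Ioi).2
    (MeasureTheory.ae_of_all _ fun t ht => ?_)
  have ht' : t₀ ≤ t := le_of_lt ht
  have h1 := norm_cross_le_one (S.norm_eq_one t ht') (H.norm_eq_one t (h0.trans ht'))
  exact (abs_real_inner_le_norm _ _).trans (mul_le_of_le_one_right (norm_nonneg _) h1)

lemma Params.IsSolution.integrableOn_dissipation (hP : P.Admissible)
    (S : P.IsSolution hs o t₀ h z) (H : IsReference hs) (h0 : 0 ≤ t₀)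
    (ho : MeasureTheory.IntegrableOn o (Set.Ioi t₀)) :
    MeasureTheory.IntegrableOn (P.dissipation hs h z) (Set.Ioi t₀)
      ∧ (∃ l, Tendsto (P.energy hs h z) atTop (𝓝 l))
      ∧ ∃ C, ∀ t, t₀ ≤ t → P.energy hs h z t ≤ C := by
  have hcz := S.continuousOn_integrator
  have hcc := S.continuousOn_cross H h0
  have hca := S.continuousOn_alphaH hP H h0
  exact integrableOn_Ioi_and_exists_tendsto
    (fun t ht => S.hasDerivWithinAt_energy hP H h0 ht)
    (fun t ht => S.energy_nonneg hP H h0 ht)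
    (by unfold dissipation; fun_prop) (fun t _ => hP.dissipation_nonneg hs h z t)
    (S.integrableOn_inner_residual H h0 ho).neg

/-- The integrable dissipation drives the heading towards `± h*`. -/
lemma Params.IsSolution.tendsto_inner_sq (hP : P.Admissible)
    (S : P.IsSolution hs o t₀ h z) (H : IsReference hs) (h0 : 0 ≤ t₀)
    (ho : MeasureTheory.IntegrableOn o (Set.Ioi t₀)) :
    Tendsto (fun t => ⟪h t, hs t⟫_ℝ ^ 2) atTop (𝓝 1) := by
  obtain ⟨hD, -, C, hC⟩ := S.integrableOn_dissipation hP H h0 ho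
  have hcz := S.continuousOn_integrator
  have hcc := S.continuousOn_cross H h0
  have hca := S.continuousOn_alphaH hP H h0
  have hci := S.continuousOn_inner H h0
  have hcr : ContinuousOn (fun t => ⟪cross (h t) (hs t), z t⟫_ℝ) (Set.Ici t₀) :=
    hcc.inner (𝕜 := ℝ) hcz
  have hor := S.integrableOn_inner_residual H h0 ho
  have hk1 := hP.kh1_pos
  have hk2 := hP.kh2_pos
  have hunit : ∀ t, t₀ ≤ t → ‖cross (h t) (hs t)‖ ^ 2 = 1 - ⟪h t, hs t⟫_ℝ ^ 2 := fun t ht =>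
    norm_cross_sq_of_unit (S.norm_eq_one t ht) (H.norm_eq_one t (h0.trans ht))
  have hc1 : ∀ t, t₀ ≤ t → |⟪h t, hs t⟫_ℝ| ≤ 1 := fun t ht =>
    abs_inner_le_one (S.norm_eq_one t ht) (H.norm_eq_one t (h0.trans ht))
  have hs1 : ∀ t, t₀ ≤ t → ‖cross (h t) (hs t)‖ ≤ 1 := fun t ht =>
    norm_cross_le_one (S.norm_eq_one t ht) (H.norm_eq_one t (h0.trans ht))
  have meas : ∀ {f : ℝ → ℝ}, ContinuousOn f (Set.Ici t₀) →
      MeasureTheory.AEStronglyMeasurable f (MeasureTheory.volume.restrict (Set.Ioi t₀)) :=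
    fun hf => (hf.mono Set.Ioi_subset_Ici_self).aestronglyMeasurable measurableSet_Ioi
  have ae : ∀ {p : ℝ → Prop}, (∀ t, t₀ ≤ t → p t) →
      ∀ᵐ t ∂(MeasureTheory.volume.restrict (Set.Ioi t₀)), p t := fun hp =>
    (MeasureTheory.ae_restrict_iff' measurableSet_Ioi).2
      (MeasureTheory.ae_of_all _ fun t ht => hp t (le_of_lt ht))
  have hsq : MeasureTheory.IntegrableOn (fun t => 1 - ⟪h t, hs t⟫_ℝ ^ 2) (Set.Ioi t₀) := by
    refine (hD.const_mul P.kh1⁻¹).mono' (meas (by fun_prop)) (ae fun t ht => ?_)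
    have h1 : 0 ≤ P.kh2 * (P.kz * (1 - P.alphaH (cross (h t) (hs t)) (z t))) * ‖z t‖ ^ 2 := by
      have := sub_nonneg.2 (hP.alphaH_mem (cross (h t) (hs t)) (z t)).2
      have := hP.kz_pos
      positivity
    rw [← hunit t ht, Real.norm_of_nonneg (by positivity), inv_mul_eq_div, le_div_iff₀ hk1,
      dissipation]
    linarith
  have hwB : ∀ t, t₀ ≤ t → P.kh2 * ‖z t‖ ^ 2 ≤ 2 * C := fun t ht => by
    have := hC t ht
    unfold energy at this
    linarith [(abs_le.1 (hc1 t ht)).2]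
  -- This is the feedback part of the derivative of `(1 - c²)²`. The square is needed: the rate of
  -- `1 - c²` itself contains `h̃·z`, of first order in `|h̃|`, while only `|h̃|²` is known to be
  -- integrable.
  have hG₁ : MeasureTheory.IntegrableOn (fun t => -4 * ⟪h t, hs t⟫_ℝ * (1 - ⟪h t, hs t⟫_ℝ ^ 2)
      * (P.kh1 * ‖cross (h t) (hs t)‖ ^ 2
        + P.kh2 * P.alphaH (cross (h t) (hs t)) (z t) * ⟪cross (h t) (hs t), z t⟫_ℝ))
      (Set.Ioi t₀) := by
    refine (hsq.const_mul (4 * (P.kh1 + P.kh2 + 2 * C))).mono' (meas (by fun_prop))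
      (ae fun t ht => ?_)
    have hx : 0 ≤ 1 - ⟪h t, hs t⟫_ℝ ^ 2 := by rw [← hunit t ht]; positivity
    have ha := hP.alphaH_mem (cross (h t) (hs t)) (z t)
    have hr : |⟪cross (h t) (hs t), z t⟫_ℝ| ≤ 1 + ‖z t‖ ^ 2 := by
      have := abs_real_inner_le_norm (cross (h t) (hs t)) (z t)
      have := mul_le_mul_of_nonneg_right (hs1 t ht) (norm_nonneg (z t))
      nlinarith [sq_nonneg (‖z t‖ - 1)]
    have h1 : |P.kh1 * ‖cross (h t) (hs t)‖ ^ 2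
          + P.kh2 * P.alphaH (cross (h t) (hs t)) (z t) * ⟪cross (h t) (hs t), z t⟫_ℝ|
        ≤ P.kh1 + P.kh2 + 2 * C := by
      refine (abs_add_le _ _).trans ?_
      rw [abs_mul, abs_mul, abs_mul, abs_of_pos hk1, abs_of_pos hk2, abs_of_pos ha.1,
        abs_of_nonneg (sq_nonneg ‖cross (h t) (hs t)‖)]
      have h2 : ‖cross (h t) (hs t)‖ ^ 2 ≤ 1 := pow_le_one₀ (norm_nonneg _) (hs1 t ht)
      have h3 : P.alphaH (cross (h t) (hs t)) (z t) * |⟪cross (h t) (hs t), z t⟫_ℝ|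
          ≤ 1 + ‖z t‖ ^ 2 := (mul_le_of_le_one_left (abs_nonneg _) ha.2).trans hr
      have h4 := mul_le_mul_of_nonneg_left h3 hk2.le
      have h5 := mul_le_mul_of_nonneg_left h2 hk1.le
      linarith [hwB t ht]
    rw [Real.norm_eq_abs, abs_mul, abs_mul, abs_mul, abs_of_nonneg hx]
    calc _ ≤ |(-4 : ℝ)| * 1 * (1 - ⟪h t, hs t⟫_ℝ ^ 2) * (P.kh1 + P.kh2 + 2 * C) := by
          gcongr
          exact hc1 t ht
      _ = _ := by norm_num; ring
  have hG₂ : MeasureTheory.IntegrableOn (fun t => -4 * ⟪h t, hs t⟫_ℝ * (1 - ⟪h t, hs t⟫_ℝ ^ 2)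
      * ⟪o t, cross (h t) (hs t)⟫_ℝ) (Set.Ioi t₀) := by
    refine (hor.norm.const_mul 4).mono' ((meas (by fun_prop)).mul hor.aestronglyMeasurable)
      (ae fun t ht => ?_)
    have hx : 0 ≤ 1 - ⟪h t, hs t⟫_ℝ ^ 2 := by rw [← hunit t ht]; positivity
    rw [norm_mul, Real.norm_eq_abs, abs_mul, abs_mul, abs_of_nonneg hx]
    gcongr
    calc _ ≤ |(-4 : ℝ)| * 1 * 1 := by
          gcongr
          · exact hc1 t ht
          · linarith [sq_nonneg ⟪h t, hs t⟫_ℝ]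
      _ = _ := by norm_num
  -- An integrable function with integrable derivative tends to zero; no pointwise bound on `o` is
  -- needed.
  have hlim : Tendsto (fun t => (1 - ⟪h t, hs t⟫_ℝ ^ 2) ^ 2) atTop (𝓝 0) := by
    refine MeasureTheory.tendsto_zero_of_hasDerivAt_of_integrableOn_Ioi (a := t₀)
      (f' := fun t => -4 * ⟪h t, hs t⟫_ℝ * (1 - ⟪h t, hs t⟫_ℝ ^ 2)
          * (P.kh1 * ‖cross (h t) (hs t)‖ ^ 2
            + P.kh2 * P.alphaH (cross (h t) (hs t)) (z t) * ⟪cross (h t) (hs t), z t⟫_ℝ)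
        + -4 * ⟪h t, hs t⟫_ℝ * (1 - ⟪h t, hs t⟫_ℝ ^ 2) * ⟪o t, cross (h t) (hs t)⟫_ℝ)
      (fun t ht => ?_) (hG₁.add hG₂) ?_
    · have := (((S.hasDerivWithinAt_inner H h0 (le_of_lt ht)).hasDerivAt
        (Ici_mem_nhds ht)).pow 2).const_sub 1 |>.pow 2
      refine this.congr_deriv ?_
      simp only [Pi.pow_apply]
      ring
    · refine hsq.mono' (meas (by fun_prop)) (ae fun t ht => ?_)
      have hx : 0 ≤ 1 - ⟪h t, hs t⟫_ℝ ^ 2 := by rw [← hunit t ht]; positivity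
      rw [Real.norm_of_nonneg (sq_nonneg _)]
      nlinarith [sq_nonneg ⟪h t, hs t⟫_ℝ]
  have h2 := (Real.continuous_sqrt.tendsto 0).comp hlim
  rw [Real.sqrt_zero] at h2
  have h3 : Tendsto (fun t => 1 - ⟪h t, hs t⟫_ℝ ^ 2) atTop (𝓝 0) := by
    refine h2.congr' ?_
    filter_upwards [eventually_ge_atTop t₀] with t ht
    exact Real.sqrt_sq (by rw [← hunit t ht]; positivity)
  simpa using h3.const_sub 1

/-- A continuous function on a half-line whose square tends to `1` tends to `1` or to `-1`. -/
lemma tendsto_one_or_neg_one {c : ℝ → ℝ} {a : ℝ} (hc : ContinuousOn c (Set.Ici a))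
    (h : Tendsto (fun t => c t ^ 2) atTop (𝓝 1)) :
    Tendsto c atTop (𝓝 1) ∨ Tendsto c atTop (𝓝 (-1)) := by
  have hsqrt : Tendsto (fun t => |c t|) atTop (𝓝 1) := by
    have := (Real.continuous_sqrt.tendsto 1).comp h
    simpa [Function.comp_def, Real.sqrt_sq_eq_abs] using this
  obtain ⟨b, hb⟩ := eventually_atTop.1 (h.eventually_const_lt zero_lt_one)
  have hne : ∀ t ∈ Set.Ici (max a b), c t ≠ 0 := fun t ht h0 => by
    have := hb t ((le_max_right a b).trans ht)
    simp [h0] at this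
  have hc' : ContinuousOn c (Set.Ici (max a b)) := hc.mono (Set.Ici_subset_Ici.2 (le_max_left a b))
  -- From `max a b` on `c` has no zero, so it keeps its sign by the intermediate value theorem.
  have hsign : (∀ t ∈ Set.Ici (max a b), 0 < c t) ∨ ∀ t ∈ Set.Ici (max a b), c t < 0 := by
    by_contra hcon
    push Not at hcon
    obtain ⟨⟨t, ht, htc⟩, u, hu, huc⟩ := hcon
    obtain ⟨v, hv, hv0⟩ := isPreconnected_Ici.intermediate_value ht hu hc' ⟨htc, huc⟩
    exact hne v hv hv0
  rcases hsign with hpos | hneg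
  · refine .inl (hsqrt.congr' ?_)
    filter_upwards [eventually_ge_atTop (max a b)] with t ht using abs_of_pos (hpos t ht)
  · refine .inr (hsqrt.neg.congr' ?_)
    filter_upwards [eventually_ge_atTop (max a b)] with t ht
    rw [abs_of_neg (hneg t ht), neg_neg]

/-- Energy and `h·h*` converge, hence `|z|` has a limit `l`, and the dissipation tends to
`k_{h,2}k_z(1-α(l))l²`. Being integrable, it tends to zero, and strict monotonicity of `α` leaves `l
= 0`. -/
lemma Params.IsSolution.tendsto_integrator (hP : P.Admissible)
    (S : P.IsSolution hs o t₀ h z) (H : IsReference hs) (h0 : 0 ≤ t₀)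
    (ho : MeasureTheory.IntegrableOn o (Set.Ioi t₀)) {c : ℝ}
    (hc : Tendsto (fun t => ⟪h t, hs t⟫_ℝ) atTop (𝓝 c)) :
    Tendsto (fun t => ‖z t‖) atTop (𝓝 0) := by
  obtain ⟨hD, ⟨V, hV⟩, -⟩ := S.integrableOn_dissipation hP H h0 ho
  have hk2 := hP.kh2_pos
  have hsq := S.tendsto_inner_sq hP H h0 ho
  have hcr : Tendsto (fun t => ‖cross (h t) (hs t)‖) atTop (𝓝 0) := by
    have := (Real.continuous_sqrt.tendsto _).comp (hsq.const_sub 1)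
    rw [sub_self, Real.sqrt_zero] at this
    refine this.congr' ?_
    filter_upwards [eventually_ge_atTop t₀] with t ht
    rw [Function.comp_apply,
      ← norm_cross_sq_of_unit (S.norm_eq_one t ht) (H.norm_eq_one t (h0.trans ht)),
      Real.sqrt_sq (norm_nonneg _)]
  obtain ⟨l, hl⟩ : ∃ l, Tendsto (fun t => ‖z t‖) atTop (𝓝 l) := by
    have h1 : Tendsto (fun t => ‖z t‖ ^ 2) atTop (𝓝 (2 / P.kh2 * (V - (1 - c)))) := by
      refine ((hV.sub (hc.const_sub 1)).const_mul (2 / P.kh2)).congr fun t => ?_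
      unfold energy
      field_simp
      ring
    refine ⟨_, ((Real.continuous_sqrt.tendsto _).comp h1).congr fun t => ?_⟩
    exact Real.sqrt_sq (norm_nonneg _)
  have hl0 : 0 ≤ l := ge_of_tendsto' hl fun _ => norm_nonneg _
  have hy : Tendsto (fun t => ‖z t + P.kz⁻¹ • cross (h t) (hs t)‖) atTop (𝓝 l) := by
    have h1 : Tendsto (fun t => P.kz⁻¹ * ‖cross (h t) (hs t)‖) atTop (𝓝 0) := by
      simpa using hcr.const_mul P.kz⁻¹
    have h2 : ∀ t, ‖P.kz⁻¹ • cross (h t) (hs t)‖ = P.kz⁻¹ * ‖cross (h t) (hs t)‖ := fun t => by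
      rw [norm_smul, Real.norm_of_nonneg (inv_pos.2 hP.kz_pos).le]
    refine tendsto_of_tendsto_of_tendsto_of_le_of_le (by simpa using hl.sub h1)
      (by simpa using hl.add h1) (fun t => ?_) fun t => ?_
    · have := norm_sub_norm_le (z t) (-(P.kz⁻¹ • cross (h t) (hs t)))
      rw [norm_neg, sub_neg_eq_add, h2] at this
      exact this
    · exact (norm_add_le _ _).trans_eq (by rw [h2])
  have ha : Tendsto (fun t => P.alphaH (cross (h t) (hs t)) (z t)) atTop (𝓝 (P.α l)) :=
    ((hP.profile.diff.continuousOn l hl0).tendsto).comp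
      (tendsto_nhdsWithin_iff.2 ⟨hy, Eventually.of_forall fun _ => norm_nonneg _⟩)
  have hDl : Tendsto (P.dissipation hs h z) atTop
      (𝓝 (P.kh1 * 0 ^ 2 + P.kh2 * (P.kz * (1 - P.α l)) * l ^ 2)) :=
    ((hcr.pow 2).const_mul P.kh1).add
      ((((ha.const_sub 1).const_mul P.kz).const_mul P.kh2).mul (hl.pow 2))
  have h5 := tendsto_eq_zero_of_integrableOn_Ioi
    (fun t _ => hP.dissipation_nonneg hs h z t) hD hDl
  rcases hl0.eq_or_lt with rfl | hpos
  · exact hl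
  · have h6 := hP.profile.strictAnti (Set.self_mem_Ici) hl0 hpos
    rw [hP.profile.at_zero] at h6
    have := hP.kz_pos
    have := sub_pos.2 h6
    have : 0 < P.kh1 * 0 ^ 2 + P.kh2 * (P.kz * (1 - P.α l)) * l ^ 2 := by
      rw [zero_pow two_ne_zero, mul_zero, zero_add]; positivity
    exact absurd h5 this.ne'

/-- Every solution with an integrable residual converges to one of the two equilibria. -/
theorem Params.IsSolution.convergesTo_or (hP : P.Admissible)
    (S : P.IsSolution hs o t₀ h z) (H : IsReference hs) (h0 : 0 ≤ t₀)
    (ho : MeasureTheory.IntegrableOn o (Set.Ioi t₀)) :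
    ConvergesTo hs h z ∨ ConvergesTo (fun t => -hs t) h z := by
  have key : ∀ {g : ℝ → ℝ}, Tendsto g atTop (𝓝 0) → Tendsto (fun t => √(2 * g t)) atTop (𝓝 0) :=
    fun hg => by
      have := (Real.continuous_sqrt.tendsto _).comp (hg.const_mul 2)
      simpa [Function.comp_def] using this
  rcases tendsto_one_or_neg_one (S.continuousOn_inner H h0) (S.tendsto_inner_sq hP H h0 ho)
    with hc | hc
  · left
    have hz := S.tendsto_integrator hP H h0 ho hc
    have h1 := (key (by simpa using hc.const_sub 1)).add hz
    rw [add_zero] at h1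
    refine h1.congr' ?_
    filter_upwards [eventually_ge_atTop t₀] with t ht
    rw [err, ← norm_sub_sq_of_unit (S.norm_eq_one t ht) (H.norm_eq_one t (h0.trans ht)),
      Real.sqrt_sq (norm_nonneg _)]
  · right
    have hz := S.tendsto_integrator hP H h0 ho hc
    have h1 := (key (by simpa using hc.const_add 1)).add hz
    rw [add_zero] at h1
    refine h1.congr' ?_
    filter_upwards [eventually_ge_atTop t₀] with t ht
    rw [err, ← norm_add_sq_of_unit (S.norm_eq_one t ht) (H.norm_eq_one t (h0.trans ht)),
      Real.sqrt_sq (norm_nonneg _)]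

lemma BoundedIntegral.integrableOn (ho : BoundedIntegral o) :
    MeasureTheory.IntegrableOn o (Set.Ioi 0) := by
  obtain ⟨hi, C, hC⟩ := ho
  -- The bounds are given for nonnegative endpoints only, hence the truncation `max t 0`.
  refine MeasureTheory.integrableOn_Ioi_of_intervalIntegral_norm_bounded C 0
    (b := fun t : ℝ => max t 0) (l := atTop) (fun t => ?_)
    (tendsto_atTop_mono (fun t => le_max_left t 0) tendsto_id)
    (Eventually.of_forall fun t => hC _ (le_max_right _ _))
  exact (intervalIntegrable_iff_integrableOn_Ioc_of_le (le_max_right t 0)).1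
    (hi _ (le_max_right t 0))

/-- Without a residual, every solution that starts with less energy than `(-h*, 0)` converges to
`(h*, 0)`. -/
theorem Params.IsSolution.convergesTo_of_energy_lt (hP : P.Admissible)
    (S : P.IsSolution hs (fun _ => 0) t₀ h z) (H : IsReference hs) (h0 : 0 ≤ t₀)
    (hE : P.energy hs h z t₀ < 2) : ConvergesTo hs h z := by
  refine (S.convergesTo_or hP H h0 (by simp)).resolve_right fun hcon => ?_
  have h1 : Tendsto (fun t => ‖h t - -hs t‖ ^ 2) atTop (𝓝 0) := by
    have : Tendsto (fun t => ‖h t - -hs t‖) atTop (𝓝 0) :=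
      squeeze_zero (fun _ => norm_nonneg _)
        (fun t => le_add_of_nonneg_right (norm_nonneg (z t))) hcon
    simpa using this.pow 2
  -- The function is `1 - h·h*`, a lower bound of the energy, so the energy could not stay below its
  -- initial value.
  have h2 : Tendsto (fun t => 2 - ‖h t - -hs t‖ ^ 2 / 2) atTop (𝓝 2) := by
    simpa using (h1.div_const 2).const_sub 2
  refine absurd (le_of_tendsto h2 ?_) (not_le.2 hE)
  filter_upwards [eventually_ge_atTop t₀] with t ht
  have h3 := S.energy_antitoneOn hP H h0 Set.self_mem_Ici ht ht
  have h4 := mul_nonneg (half_pos hP.kh2_pos).le (sq_nonneg ‖z t‖)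
  rw [norm_add_sq_of_unit (S.norm_eq_one t ht) (H.norm_eq_one t (h0.trans ht))]
  have h5 : P.energy hs h z t = 1 - ⟪h t, hs t⟫_ℝ + P.kh2 / 2 * ‖z t‖ ^ 2 := rfl
  linarith

lemma inner_lt_of_ne_neg {a b : E3} (ha : ‖a‖ = 1) (hb : ‖b‖ = 1) (hab : a ≠ -b) :
    -1 < ⟪a, b⟫_ℝ := by
  have h1 := norm_add_sq_of_unit ha hb
  have h2 : 0 < ‖a - -b‖ := norm_pos_iff.2 (sub_ne_zero.2 hab)
  have := pow_pos h2 2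
  linarith

end Convergence

/-! ### Strict Lyapunov function and exponential decay -/

/-- The function `U e^{νt} + N/(lam-ν) e^{(ν-lam)t}` is nonincreasing. A rate `ν` strictly below
`lam` avoids the resonance `κ = lam`. -/
lemma le_mul_exp_of_hasDerivWithinAt_le {U U' : ℝ → ℝ} {T κ ν lam N : ℝ}
    (hU : ∀ t, T ≤ t → HasDerivWithinAt U (U' t) (Set.Ici T) t) (hU0 : ∀ t, T ≤ t → 0 ≤ U t)
    (hle : ∀ t, T ≤ t → U' t ≤ -κ * U t + N * Real.exp (-lam * t)) (hN : 0 ≤ N)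
    (hν : ν ≤ κ) (hlam : ν < lam) {t : ℝ} (ht : T ≤ t) :
    U t ≤ (U T * Real.exp (ν * T) + N / (lam - ν) * Real.exp ((ν - lam) * T))
      * Real.exp (-ν * t) := by
  have hpos : 0 < lam - ν := sub_pos.2 hlam
  have hexp : ∀ (q s : ℝ), HasDerivWithinAt (fun s => Real.exp (q * s)) (Real.exp (q * s) * q)
      (Set.Ici T) s := fun q s => by
    simpa using (((hasDerivAt_id s).const_mul q).exp).hasDerivWithinAt
  have hanti := antitoneOn_Ici_of_hasDerivWithinAt_nonpos
    (fun s hs => ((hU s hs).mul (hexp ν s)).add ((hexp (ν - lam) s).const_mul (N / (lam - ν))))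
    fun s hs => by
      have h1 := hle s hs
      have h2 : Real.exp ((ν - lam) * s) = Real.exp (-lam * s) * Real.exp (ν * s) := by
        rw [← Real.exp_add]; congr 1; ring
      have h3 : N / (lam - ν) * (Real.exp ((ν - lam) * s) * (ν - lam))
          = -(N * Real.exp (-lam * s)) * Real.exp (ν * s) := by
        rw [h2]; field_simp; ring
      rw [h3]
      have h4 : U' s + U s * ν + -(N * Real.exp (-lam * s)) ≤ 0 := by
        have := mul_nonneg (sub_nonneg.2 hν) (hU0 s hs)
        nlinarith
      calc _ = (U' s + U s * ν + -(N * Real.exp (-lam * s))) * Real.exp (ν * s) := by ring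
        _ ≤ 0 := mul_nonpos_of_nonpos_of_nonneg h4 (Real.exp_pos _).le
  have h5 := hanti Set.self_mem_Ici ht ht
  simp only [Pi.add_apply, Pi.mul_apply] at h5
  have h6 : 0 ≤ N / (lam - ν) * Real.exp ((ν - lam) * t) := by positivity
  calc U t = U t * Real.exp (ν * t) * Real.exp (-ν * t) := by
        rw [mul_assoc, ← Real.exp_add]; simp
    _ ≤ _ := by
        gcongr
        linarith

/-- Constants for the strict Lyapunov function `1 - h·h* + k_{h,2} |z|² / 2 + ε h̃·z`. -/
lemma Params.Admissible.exists_lyapunov_constants {P : Params} (hP : P.Admissible) :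
    ∃ ε κ m M : ℝ, 0 < ε ∧ 0 < κ ∧ 0 < m ∧ 0 < M ∧ ∀ c a s w r : ℝ, 1 / 2 ≤ c → c ≤ 1 →
      1 / 2 ≤ a → a ≤ 1 → 0 ≤ s → 0 ≤ w → s ^ 2 = 1 - c ^ 2 → |r| ≤ s * w →
      m * (s ^ 2 + w ^ 2) ≤ 1 - c + P.kh2 / 2 * w ^ 2 + ε * r ∧
      1 - c + P.kh2 / 2 * w ^ 2 + ε * r ≤ M * (s ^ 2 + w ^ 2) ∧
      -(P.kh1 * s ^ 2 + P.kh2 * (P.kz * (1 - a)) * w ^ 2)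
          + ε * (-((c * P.kh1 + P.kz * (1 - a)) * r) - c * P.kh2 * a * w ^ 2 + a * s ^ 2)
        ≤ -κ * (1 - c + P.kh2 / 2 * w ^ 2 + ε * r) := by
  have hk1 := hP.kh1_pos
  have hk2 := hP.kh2_pos
  have hkz := hP.kz_pos
  set k1 := P.kh1
  set k2 := P.kh2
  set kz := P.kz
  set K := k1 + kz with hK
  -- `B` collects the coefficients of `s²`: `1` from `a s²`, and `2K²/k2` from completing the square
  -- in `K s w ≤ k2/8 w² + (2K²/k2) s²`.
  set B := 1 + 2 * K ^ 2 / k2 with hB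
  have hBpos : 0 < B := by positivity
  -- The first bound on `ε` leaves half of the dissipation in `s`; the other two keep the perturbed
  -- energy positive definite.
  obtain ⟨ε, hε, hε1, hε2, hε3⟩ : ∃ ε : ℝ, 0 < ε ∧ ε * B ≤ k1 / 2 ∧ ε ≤ 1 / 2 ∧ ε ≤ k2 / 2 := by
    refine ⟨min (k1 / 2 / B) (min (1 / 2) (k2 / 2)), by positivity, ?_, ?_, ?_⟩
    · exact (le_div_iff₀ hBpos).1 (min_le_left _ _)
    · exact (min_le_right _ _).trans (min_le_left _ _)
    · exact (min_le_right _ _).trans (min_le_right _ _)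
  set m := min (1 / 4) (k2 / 4) with hm
  set μ := min (k1 / 2) (ε * k2 / 8) with hμ
  have hmpos : 0 < m := by positivity
  have hμpos : 0 < μ := by positivity
  have hM : 0 < 1 + k2 / 2 + ε := by positivity
  refine ⟨ε, μ / (1 + k2 / 2 + ε), m, 1 + k2 / 2 + ε, hε, by positivity, hmpos, hM, ?_⟩
  intro c a s w r hc hc1 ha ha1 hs hw hsc hr
  obtain ⟨hr1, hr2⟩ := abs_le.1 hr
  have hsw : s * w ≤ (s ^ 2 + w ^ 2) / 2 := by nlinarith [sq_nonneg (s - w)]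
  have hs2 := sq_nonneg s
  have hw2 := sq_nonneg w
  have hup : 1 - c + k2 / 2 * w ^ 2 + ε * r ≤ (1 + k2 / 2 + ε) * (s ^ 2 + w ^ 2) := by
    -- Here `s² = (1-c)(1+c)` with `1 + c` between `3/2` and `2`.
    have h1 : 1 - c ≤ s ^ 2 := by nlinarith
    have h2 : ε * r ≤ ε * (s ^ 2 + w ^ 2) := by
      apply mul_le_mul_of_nonneg_left _ hε.le; linarith
    nlinarith [mul_nonneg hk2.le hs2]
  refine ⟨?_, hup, ?_⟩
  · have h1 : s ^ 2 / 2 ≤ 1 - c := by nlinarith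
    have h2 : ε * -r ≤ ε * ((s ^ 2 + w ^ 2) / 2) := by
      apply mul_le_mul_of_nonneg_left _ hε.le; linarith
    have h3 : m * s ^ 2 ≤ 1 / 4 * s ^ 2 := mul_le_mul_of_nonneg_right (min_le_left _ _) hs2
    have h4 : m * w ^ 2 ≤ k2 / 4 * w ^ 2 := mul_le_mul_of_nonneg_right (min_le_right _ _) hw2
    have h5 := mul_le_mul_of_nonneg_right hε2 hs2
    have h6 := mul_le_mul_of_nonneg_right hε3 hw2
    linarith
  · have h1 : -((c * k1 + kz * (1 - a)) * r) ≤ K * (s * w) := by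
      have h2 : 0 ≤ c * k1 + kz * (1 - a) := by
        have := mul_nonneg hkz.le (sub_nonneg.2 ha1)
        have : 0 ≤ c * k1 := mul_nonneg (by linarith) hk1.le
        linarith
      have h3 : c * k1 + kz * (1 - a) ≤ K := by nlinarith
      calc _ = (c * k1 + kz * (1 - a)) * -r := by ring
        _ ≤ (c * k1 + kz * (1 - a)) * (s * w) := by
          apply mul_le_mul_of_nonneg_left _ h2; linarith
        _ ≤ _ := mul_le_mul_of_nonneg_right h3 (mul_nonneg hs hw)
    have h2 : K * (s * w) ≤ k2 / 8 * w ^ 2 + (B - 1) * s ^ 2 := by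
      have h3 : k2 / 8 * w ^ 2 + (B - 1) * s ^ 2 - K * (s * w) = (k2 * w - 4 * K * s) ^ 2 / (8 * k2) := by
        rw [hB]; field_simp; ring
      have : 0 ≤ (k2 * w - 4 * K * s) ^ 2 / (8 * k2) := by positivity
      linarith
    have h3 : k2 / 4 * w ^ 2 ≤ c * k2 * a * w ^ 2 := by
      have : 1 / 4 ≤ c * a := by nlinarith
      have := mul_le_mul_of_nonneg_right this (mul_nonneg hk2.le hw2)
      linarith
    have h4 : a * s ^ 2 ≤ s ^ 2 := mul_le_of_le_one_left hs2 ha1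
    have h5 : -((c * k1 + kz * (1 - a)) * r) - c * k2 * a * w ^ 2 + a * s ^ 2
        ≤ B * s ^ 2 - k2 / 8 * w ^ 2 := by linarith
    have h6 := mul_le_mul_of_nonneg_left h5 hε.le
    have h7 := mul_le_mul_of_nonneg_right hε1 hs2
    have h8 : 0 ≤ k2 * (kz * (1 - a)) * w ^ 2 := by
      have := sub_nonneg.2 ha1
      positivity
    have h9 : μ * s ^ 2 ≤ k1 / 2 * s ^ 2 := mul_le_mul_of_nonneg_right (min_le_left _ _) hs2
    have h10 : μ * w ^ 2 ≤ ε * k2 / 8 * w ^ 2 := mul_le_mul_of_nonneg_right (min_le_right _ _) hw2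
    have h11 : μ / (1 + k2 / 2 + ε) * (1 - c + k2 / 2 * w ^ 2 + ε * r) ≤ μ * (s ^ 2 + w ^ 2) := by
      rw [div_mul_eq_mul_div, div_le_iff₀ hM]
      calc _ ≤ μ * ((1 + k2 / 2 + ε) * (s ^ 2 + w ^ 2)) := mul_le_mul_of_nonneg_left hup hμpos.le
        _ = _ := by ring
    linarith

/-- A neighbourhood of `(h*, 0)` where `h·h*` and the gain `α_h` are at least one half. -/
lemma Params.Admissible.exists_radius {P : Params} (hP : P.Admissible) :
    ∃ ρ : ℝ, 0 < ρ ∧ ∀ h k z : E3, ‖h‖ = 1 → ‖k‖ = 1 → ‖h - k‖ ≤ ρ → ‖z‖ ≤ ρ →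
      1 / 2 ≤ ⟪h, k⟫_ℝ ∧ 1 / 2 ≤ P.alphaH (cross h k) z := by
  have h1 : Tendsto P.α (𝓝[Set.Ici 0] 0) (𝓝 1) := by
    simpa [hP.profile.at_zero] using (hP.profile.diff.continuousOn 0 Set.self_mem_Ici).tendsto
  have hkz := hP.kz_pos
  obtain ⟨r, hr, hball⟩ := Metric.mem_nhdsWithin_iff.1
    (h1.eventually_const_le (show (1 / 2 : ℝ) < 1 by norm_num))
  have hq : 0 < 1 + P.kz⁻¹ := by positivity
  -- Radius `1` gives `2(1 - h·k) ≤ 1`; the other bound keeps the argument of `α` within `r/2`,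
  -- because `|h × k| ≤ |h - k|`.
  refine ⟨min 1 (r / 2 / (1 + P.kz⁻¹)), by positivity, fun h k z hh hk hhk hz => ⟨?_, ?_⟩⟩
  · have h2 := norm_sub_sq_of_unit hh hk
    have h3 : ‖h - k‖ ^ 2 ≤ 1 := pow_le_one₀ (norm_nonneg _) (hhk.trans (min_le_left _ _))
    linarith
  · refine hball ⟨?_, norm_nonneg _⟩
    have h2 : ‖cross h k‖ ≤ ‖h - k‖ := by
      have := norm_cross_le (h - k) k
      rw [sub_eq_add_neg, cross_add_left, cross_neg_left, cross_self, neg_zero, add_zero, hk,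
        mul_one, ← sub_eq_add_neg] at this
      exact this
    have h3 := (le_div_iff₀ hq).1 (hhk.trans (min_le_right _ _))
    have h4 := (le_div_iff₀ hq).1 (hz.trans (min_le_right _ _))
    set ρ := min 1 (r / 2 / (1 + P.kz⁻¹))
    have h5 : ‖z + P.kz⁻¹ • cross h k‖ ≤ ρ * (1 + P.kz⁻¹) := by
      refine (norm_add_le _ _).trans ?_
      rw [norm_smul, Real.norm_of_nonneg (by positivity)]
      have := mul_le_mul_of_nonneg_left (h2.trans hhk) (inv_pos.2 hkz).le
      linarith
    have h6 := (le_div_iff₀ hq).1 (min_le_right 1 (r / 2 / (1 + P.kz⁻¹)))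
    rw [Metric.mem_ball, dist_zero_right, norm_norm]
    linarith

section Decay

variable {P : Params} {hs o h z : ℝ → E3} {t₀ T t : ℝ}

lemma err_nonneg (e h z : ℝ → E3) (t : ℝ) : 0 ≤ err e h z t := by unfold err; positivity

lemma Params.IsSolution.mono (S : P.IsSolution hs o t₀ h z) (hT : t₀ ≤ T) :
    P.IsSolution hs o T h z where
  norm_eq_one t ht := S.norm_eq_one t (hT.trans ht)
  heading t ht := (S.heading t (hT.trans ht)).mono (Set.Ici_subset_Ici.2 hT)
  integrator t ht := (S.integrator t (hT.trans ht)).mono (Set.Ici_subset_Ici.2 hT)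

/-- Solutions that stay near `(h*, 0)` admit a function equivalent to `err ^ 2` that decreases
exponentially, up to the effect of the residual. -/
lemma Params.Admissible.exists_strict_lyapunov (hP : P.Admissible) :
    ∃ ρ κ C₁ C₂ C₃ : ℝ, 0 < ρ ∧ 0 < κ ∧ 0 < C₁ ∧ 0 < C₂ ∧ 0 < C₃ ∧
      ∀ hs o h z : ℝ → E3, IsReference hs → ∀ t₀, 0 ≤ t₀ → P.IsSolution hs o t₀ h z →
        ⟪z t₀, hs t₀⟫_ℝ = 0 → (∀ t, t₀ ≤ t → ‖h t - hs t‖ ≤ ρ ∧ ‖z t‖ ≤ ρ) →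
        ∃ U U' : ℝ → ℝ, ∀ t, t₀ ≤ t → HasDerivWithinAt U (U' t) (Set.Ici t₀) t ∧
          U' t ≤ -κ * U t + C₃ * ‖o t‖ ∧ err hs h z t ^ 2 ≤ C₁ * U t ∧
          U t ≤ C₂ * err hs h z t ^ 2 := by
  obtain ⟨ε, κ, m, M, hε, hκ, hm, hM, key⟩ := hP.exists_lyapunov_constants
  obtain ⟨ρ, hρ, hreg⟩ := hP.exists_radius
  -- The `4` comes from `err² ≤ 2|h-h*|² + 2|z|²` and `|h-h*|² ≤ 2|h̃|²`. The residual costs `|o|`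
  -- in the energy and twice `ρ|o|` in the cross term.
  refine ⟨ρ, κ, 4 / m, M, 1 + ε * (2 * ρ), hρ, hκ, by positivity, hM, by positivity, ?_⟩
  intro hs o h z H t₀ h0 S hz0 hnear
  refine ⟨fun t => P.energy hs h z t + ε * ⟪cross (h t) (hs t), z t⟫_ℝ, _, fun t ht =>
    ⟨(S.hasDerivWithinAt_energy hP H h0 ht).add
      ((S.hasDerivWithinAt_inner_cross hP H h0 hz0 ht).const_mul ε), ?_⟩⟩
  have hh := S.norm_eq_one t ht
  have hk := H.norm_eq_one t (h0.trans ht)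
  obtain ⟨hc, ha⟩ := hreg _ _ _ hh hk (hnear t ht).1 (hnear t ht).2
  have hzρ := (hnear t ht).2
  have hc1 := (abs_le.1 (abs_inner_le_one hh hk)).2
  have hs2 := norm_cross_sq_of_unit hh hk
  have hs1 := norm_cross_le_one hh hk
  obtain ⟨k1, k2, k3⟩ := key _ _ _ _ _ hc hc1 ha (hP.alphaH_mem _ _).2 (norm_nonneg _)
    (norm_nonneg (z t)) hs2 (abs_real_inner_le_norm _ (z t))
  have hd := norm_sub_sq_of_unit hh hk
  refine ⟨?_, ?_, ?_⟩
  · have e1 : -⟪o t, cross (h t) (hs t)⟫_ℝ ≤ ‖o t‖ := by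
      have := (abs_le.1 (abs_real_inner_le_norm (o t) (cross (h t) (hs t)))).1
      have := mul_le_of_le_one_right (norm_nonneg (o t)) hs1
      linarith
    have e2 : ⟪o t, hs t⟫_ℝ * ⟪h t, z t⟫_ℝ ≤ ‖o t‖ * ρ := by
      have f1 := abs_real_inner_le_norm (o t) (hs t)
      have f2 := abs_real_inner_le_norm (h t) (z t)
      rw [hk, mul_one] at f1
      rw [hh, one_mul] at f2
      calc _ ≤ |⟪o t, hs t⟫_ℝ * ⟪h t, z t⟫_ℝ| := le_abs_self _
        _ = |⟪o t, hs t⟫_ℝ| * |⟪h t, z t⟫_ℝ| := abs_mul _ _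
        _ ≤ _ := mul_le_mul f1 (f2.trans hzρ) (abs_nonneg _) (norm_nonneg _)
    have e3 : -(⟪h t, hs t⟫_ℝ * ⟪o t, z t⟫_ℝ) ≤ ‖o t‖ * ρ := by
      have f1 := abs_inner_le_one hh hk
      have f2 := abs_real_inner_le_norm (o t) (z t)
      calc _ ≤ |⟪h t, hs t⟫_ℝ * ⟪o t, z t⟫_ℝ| := neg_le_abs _
        _ = |⟪h t, hs t⟫_ℝ| * |⟪o t, z t⟫_ℝ| := abs_mul _ _
        _ ≤ 1 * (‖o t‖ * ρ) := mul_le_mul f1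
          (f2.trans (mul_le_mul_of_nonneg_left hzρ (norm_nonneg _))) (abs_nonneg _) zero_le_one
        _ = _ := one_mul _
    have e4 : ε * (⟪o t, hs t⟫_ℝ * ⟪h t, z t⟫_ℝ - ⟪h t, hs t⟫_ℝ * ⟪o t, z t⟫_ℝ)
        ≤ ε * (‖o t‖ * ρ + ‖o t‖ * ρ) := mul_le_mul_of_nonneg_left (by linarith) hε.le
    unfold dissipation energy
    linarith
  · have e1 : ‖h t - hs t‖ ^ 2 ≤ 2 * ‖cross (h t) (hs t)‖ ^ 2 := by nlinarith
    have e2 : err hs h z t ^ 2 ≤ 4 * (‖cross (h t) (hs t)‖ ^ 2 + ‖z t‖ ^ 2) := by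
      unfold err
      nlinarith [sq_nonneg (‖h t - hs t‖ - ‖z t‖), sq_nonneg ‖z t‖]
    have e3 : err hs h z t ^ 2 ≤ 4 / m * (m * (‖cross (h t) (hs t)‖ ^ 2 + ‖z t‖ ^ 2)) := by
      rw [← mul_assoc, div_mul_cancel₀ _ hm.ne']; exact e2
    exact e3.trans (mul_le_mul_of_nonneg_left k1 (by positivity))
  · refine k2.trans (mul_le_mul_of_nonneg_left ?_ hM.le)
    have e1 : ‖cross (h t) (hs t)‖ ^ 2 ≤ ‖h t - hs t‖ ^ 2 := by nlinarith
    have e2 : 0 ≤ ‖h t - hs t‖ * ‖z t‖ := by positivity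
    unfold err
    nlinarith

/-- Monotonicity of the energy traps the solution in the ball of radius `ρ`, where the strict
Lyapunov function applies. -/
theorem Params.Admissible.expStableWith (hP : P.Admissible) :
    ∃ δ K lam : ℝ, 0 < δ ∧ 0 < K ∧ 0 < lam ∧ ∀ hs : ℝ → E3,
      IsReference hs → P.ExpStableWith δ K lam hs hs := by
  obtain ⟨ρ, κ, C₁, C₂, C₃, hρ, hκ, hC₁, hC₂, -, key⟩ := hP.exists_strict_lyapunov
  have hk2 := hP.kh2_pos
  -- With this `θ`, twice the initial energy is at most `min(1, k_{h,2}) ρ²`, which bounds both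
  -- `|h-h*|` and `|z|` by `ρ`.
  set θ := min 1 P.kh2 / (1 + P.kh2) with hθ
  have hθ0 : 0 < θ := by positivity
  have hθ1 : θ * (1 + P.kh2) = min 1 P.kh2 := div_mul_cancel₀ _ (by positivity)
  have hθ2 : θ ≤ 1 := (div_le_one (by positivity)).2 ((min_le_left _ _).trans (by linarith))
  refine ⟨ρ * θ, √(C₁ * C₂), κ / 2, by positivity, by positivity, by positivity, ?_⟩
  intro hs H t₀ h0 h z S hz0 hδ t ht
  have hE0 : (2 : ℝ) * P.energy hs h z t₀ ≤ (1 + P.kh2) * (ρ * θ) ^ 2 := by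
    have h1 := norm_sub_sq_of_unit (S.norm_eq_one t₀ le_rfl) (H.norm_eq_one t₀ h0)
    have h2 : ‖h t₀ - hs t₀‖ ^ 2 ≤ (ρ * θ) ^ 2 := by
      refine pow_le_pow_left₀ (norm_nonneg _) (le_trans ?_ hδ.le) 2
      exact le_add_of_nonneg_right (norm_nonneg _)
    have h3 : ‖z t₀‖ ^ 2 ≤ (ρ * θ) ^ 2 := by
      refine pow_le_pow_left₀ (norm_nonneg _) (le_trans ?_ hδ.le) 2
      exact le_add_of_nonneg_left (norm_nonneg _)
    have h4 := mul_le_mul_of_nonneg_left h3 hk2.le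
    unfold energy
    linarith
  have hbound : (1 + P.kh2) * (ρ * θ) ^ 2 ≤ min 1 P.kh2 * ρ ^ 2 := by
    calc _ = (θ * (1 + P.kh2)) * ρ ^ 2 * θ := by ring
      _ ≤ _ := by rw [hθ1]; exact mul_le_of_le_one_right (by positivity) hθ2
  have hnear : ∀ t, t₀ ≤ t → ‖h t - hs t‖ ≤ ρ ∧ ‖z t‖ ≤ ρ := fun t ht => by
    have h1 := norm_sub_sq_of_unit (S.norm_eq_one t ht) (H.norm_eq_one t (h0.trans ht))
    have h2 := S.energy_antitoneOn hP H h0 Set.self_mem_Ici ht ht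
    have h3 : 2 * P.energy hs h z t = ‖h t - hs t‖ ^ 2 + P.kh2 * ‖z t‖ ^ 2 := by
      unfold energy; linarith
    have h4 : ‖h t - hs t‖ ^ 2 + P.kh2 * ‖z t‖ ^ 2 ≤ min 1 P.kh2 * ρ ^ 2 := by linarith
    have h5 := mul_le_mul_of_nonneg_right (min_le_left 1 P.kh2) (sq_nonneg ρ)
    have h6 := mul_le_mul_of_nonneg_right (min_le_right 1 P.kh2) (sq_nonneg ρ)
    constructor
    · refine le_of_sq_le_sq ?_ hρ.le
      linarith [mul_nonneg hk2.le (sq_nonneg ‖z t‖)]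
    · refine le_of_sq_le_sq ?_ hρ.le
      refine le_of_mul_le_mul_left ?_ hk2
      linarith [sq_nonneg ‖h t - hs t‖]
  obtain ⟨U, U', hU⟩ := key hs _ h z H t₀ h0 S hz0 hnear
  have hU0 : ∀ t, t₀ ≤ t → 0 ≤ U t := fun t ht =>
    nonneg_of_mul_nonneg_right ((sq_nonneg _).trans (hU t ht).2.2.1) hC₁
  -- There is no forcing, so `lam` is any number above `ν`.
  have hdecay := le_mul_exp_of_hasDerivWithinAt_le (κ := κ) (ν := κ) (lam := κ + 1) (N := 0)
    (fun t ht => (hU t ht).1) hU0 (fun t ht => by simpa using (hU t ht).2.1) le_rfl le_rfl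
    (by linarith) ht
  refine le_of_sq_le_sq ?_ (mul_nonneg (by positivity) (err_nonneg _ _ _ _))
  have he : Real.exp (κ * t₀) * Real.exp (-κ * t) = Real.exp (-(κ / 2) * (t - t₀)) ^ 2 := by
    rw [← Real.exp_add, ← Real.exp_nat_mul]; congr 1; push_cast; ring
  rw [mul_pow, mul_pow, Real.sq_sqrt (by positivity), ← he]
  calc err hs h z t ^ 2 ≤ C₁ * U t := (hU t ht).2.2.1
    _ ≤ C₁ * (U t₀ * Real.exp (κ * t₀) * Real.exp (-κ * t)) := by
      simp only [zero_div, zero_mul, add_zero] at hdecay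
      exact mul_le_mul_of_nonneg_left hdecay hC₁.le
    _ ≤ C₁ * ((C₂ * err hs h z t₀ ^ 2) * Real.exp (κ * t₀) * Real.exp (-κ * t)) := by
      gcongr
      exact (hU t₀ le_rfl).2.2.2
    _ = _ := by ring

/-- Convergence brings the solution into the ball of radius `ρ` for good; from then on the residual
is an exponentially small forcing of the strict Lyapunov function. -/
theorem Params.IsSolution.ultimatelyExp_err (hP : P.Admissible) (S : P.IsSolution hs o t₀ h z)
    (H : IsReference hs) (h0 : 0 ≤ t₀) (hz0 : ⟪z t₀, hs t₀⟫_ℝ = 0) (hconv : ConvergesTo hs h z)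
    (ho : UltimatelyExp fun t => ‖o t‖) : UltimatelyExp (err hs h z) := by
  obtain ⟨ρ, κ, C₁, C₂, C₃, hρ, hκ, hC₁, -, hC₃, key⟩ := hP.exists_strict_lyapunov
  obtain ⟨N, lam, T₁, hlam, hN⟩ := ho
  obtain ⟨T₂, hT₂⟩ := eventually_atTop.1 (hconv.eventually_le_const hρ)
  set T := max t₀ (max T₁ T₂)
  have hT0 : t₀ ≤ T := le_max_left _ _
  have hT1 : T₁ ≤ T := (le_max_left _ _).trans (le_max_right _ _)
  have hT2 : T₂ ≤ T := (le_max_right _ _).trans (le_max_right _ _)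
  obtain ⟨U, U', hU⟩ := key hs o h z H T (h0.trans hT0) (S.mono hT0)
    (S.inner_integrator_eq_zero hP H h0 hz0 hT0) fun t ht =>
      ⟨(le_add_of_nonneg_right (norm_nonneg _)).trans (hT₂ t (hT2.trans ht)),
        (le_add_of_nonneg_left (norm_nonneg _)).trans (hT₂ t (hT2.trans ht))⟩
  have hU0 : ∀ t, T ≤ t → 0 ≤ U t := fun t ht =>
    nonneg_of_mul_nonneg_right ((sq_nonneg _).trans (hU t ht).2.2.1) hC₁
  have hle : ∀ t, T ≤ t → U' t ≤ -κ * U t + C₃ * |N| * Real.exp (-lam * t) := fun t ht => by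
    have h1 := hN t (hT1.trans ht)
    have h2 : ‖o t‖ ≤ |N| * Real.exp (-lam * t) :=
      h1.trans (mul_le_mul_of_nonneg_right (le_abs_self N) (Real.exp_pos _).le)
    have h3 := mul_le_mul_of_nonneg_left h2 hC₃.le
    linarith [(hU t ht).2.1]
  -- Half of `lam` keeps `ν` strictly below `lam`.
  set ν := min κ (lam / 2) with hν
  have hν0 : 0 < ν := by positivity
  have hνlam : ν < lam := (min_le_right _ _).trans_lt (half_lt_self hlam)
  set D := U T * Real.exp (ν * T) + C₃ * |N| / (lam - ν) * Real.exp ((ν - lam) * T)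
  have hD : 0 ≤ D := by
    have := hU0 T le_rfl
    have := sub_pos.2 hνlam
    positivity
  refine ⟨√(C₁ * D), ν / 2, T, by positivity, fun t ht => ?_⟩
  refine le_of_sq_le_sq ?_ (by positivity)
  have hdecay : U t ≤ D * Real.exp (-ν * t) := le_mul_exp_of_hasDerivWithinAt_le
    (fun t ht => (hU t ht).1) hU0 hle (by positivity) (min_le_left _ _) hνlam ht
  have he : Real.exp (-ν * t) = Real.exp (-(ν / 2) * t) ^ 2 := by
    rw [← Real.exp_nat_mul]; congr 1; push_cast; ring
  rw [mul_pow, Real.sq_sqrt (by positivity), ← he, mul_assoc]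
  exact (hU t ht).2.2.1.trans (mul_le_mul_of_nonneg_left hdecay hC₁.le)

end Decay

/-! ### The equilibria -/

section Equilibria

variable {P : Params} {hs h z : ℝ → E3} {t : ℝ}

lemma Params.feedback_zero (P : Params) {k h z : E3} (hz : z = 0) (hk : cross h k = 0) :
    P.feedback k 0 h z = 0 := by
  simp [feedback, hz, hk]

/-- A curve of headings parallel to `h*`, with `z = 0`, is an equilibrium. -/
lemma Params.Admissible.isEquilibrium (hP : P.Admissible) (H : IsReference hs) {σ : ℝ}
    (hσ : σ ^ 2 = 1) (hh : ∀ t, 0 ≤ t → h t = σ • hs t ∧ z t = 0) : P.IsEquilibrium hs h z := by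
  have hc : ∀ t, 0 ≤ t → cross (h t) (hs t) = 0 := fun t ht => by
    rw [(hh t ht).1, cross_smul_left, cross_self, smul_zero]
  have hrest : ∀ t, 0 ≤ t →
      HasDerivWithinAt h (cross (omegaRef hs t) (h t)) (Set.Ici 0) t := fun t ht => by
    rw [(hh t ht).1, cross_smul_right]
    exact ((H.hasDerivWithinAt ht).const_smul σ).congr (fun s hs => (hh s hs).1) (hh t ht).1
  have zrest : ∀ t, 0 ≤ t →
      HasDerivWithinAt z (cross (omegaRef hs t) (z t)) (Set.Ici 0) t := fun t ht => by
    rw [(hh t ht).2, cross_zero_right]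
    exact (hasDerivWithinAt_const t (Set.Ici 0) (0 : E3)).congr (fun s hs => (hh s hs).2) (hh t ht).2
  refine ⟨⟨fun t ht => ?_, fun t ht => ?_, fun t ht => ?_⟩, hrest, zrest⟩
  · rw [(hh t ht).1, norm_smul, H.norm_eq_one t ht, mul_one, Real.norm_eq_abs]
    exact (pow_eq_one_iff_of_nonneg (abs_nonneg σ) two_ne_zero).1 (by rw [sq_abs, hσ])
  · rw [P.cross_omegaH, P.feedback_zero (hh t ht).2 (hc t ht), cross_zero_left, add_zero]
    exact hrest t ht
  · rw [P.zRate_eq hP.kz_pos.ne', hc t ht, smul_zero, add_zero]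
    nth_rw 3 [(hh t ht).2]
    rw [smul_zero, sub_zero]
    exact zrest t ht

/-- Rest of `z` gives `h̃ = μ z` with `μ ≥ 0`, so the feedback is a positive multiple of `z`, and
rest of `h` makes `z` parallel to `h`. But `h̃` is orthogonal to `h`, so `h̃ = μ z = 0`. Then `(1 -
α(|z|)) z = 0`, and strictness of `α` gives `z = 0`. -/
lemma Params.IsEquilibrium.eq_zero (hP : P.Admissible) (E : P.IsEquilibrium hs h z) (ht : 0 ≤ t) :
    z t = 0 ∧ cross (h t) (hs t) = 0 := by
  have hu := uniqueDiffOn_Ici (0 : ℝ) t ht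
  have e1 := hu.eq_deriv _ (E.isSolution.heading t ht) (E.heading_at_rest t ht)
  have e2 := hu.eq_deriv _ (E.isSolution.integrator t ht) (E.integrator_at_rest t ht)
  rw [P.cross_omegaH, add_eq_left, feedback, add_zero] at e1
  rw [P.zRate_eq hP.kz_pos.ne'] at e2
  have hα : P.alphaH (cross (h t) (hs t)) (z t) = P.α ‖z t + P.kz⁻¹ • cross (h t) (hs t)‖ := rfl
  have ha := hP.alphaH_mem (cross (h t) (hs t)) (z t)
  set a := P.alphaH (cross (h t) (hs t)) (z t)
  set v := cross (h t) (hs t) with hv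
  have hk1 := hP.kh1_pos
  have hk2 := hP.kh2_pos
  have hkz := hP.kz_pos
  have ha1 := sub_nonneg.2 ha.2
  have e3 : a • v = (P.kz * (1 - a)) • z t := by
    rw [sub_add_eq_add_sub, add_sub_assoc, add_eq_left, sub_eq_zero] at e2
    exact e2
  have e4 : v = (P.kz * (1 - a) / a) • z t := by
    rw [div_eq_inv_mul, mul_smul, ← e3, smul_smul, inv_mul_cancel₀ ha.1.ne', one_smul]
  set μ := P.kz * (1 - a) / a
  have hμ : 0 ≤ μ := div_nonneg (mul_nonneg hkz.le ha1) ha.1.le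
  have e5 : cross (z t) (h t) = 0 := by
    rw [e4, smul_smul, ← add_smul, cross_smul_left] at e1
    have : 0 < P.kh1 * μ + P.kh2 * a := by
      have := mul_pos hk2 ha.1
      positivity
    exact (smul_eq_zero.1 e1).resolve_left this.ne'
  have hvh : ⟪v, h t⟫_ℝ = 0 := inner_cross_self_left _ _
  have e6 : μ • z t = 0 := by
    have e7 : ‖z t‖ ^ 2 = ⟪z t, h t⟫_ℝ ^ 2 := by
      have := norm_cross_sq (z t) (h t)
      rw [e5, E.isSolution.norm_eq_one t ht, norm_zero] at this
      linarith
    rw [e4, real_inner_smul_left] at hvh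
    rcases mul_eq_zero.1 hvh with h0 | h0
    · rw [h0, zero_smul]
    · rw [h0, zero_pow two_ne_zero, sq_eq_zero_iff, norm_eq_zero] at e7
      rw [e7, smul_zero]
  rw [e6] at e4
  refine ⟨?_, e4⟩
  rw [e4, smul_zero] at e3
  rcases smul_eq_zero.1 e3.symm with h0 | h0
  · have h1 : a = 1 := by
      rcases mul_eq_zero.1 h0 with h2 | h2
      · exact absurd h2 hkz.ne'
      · linarith
    rw [h1, e4, smul_zero, add_zero] at hα
    by_contra hz
    have := hP.profile.strictAnti Set.self_mem_Ici (norm_nonneg (z t)) (norm_pos_iff.2 hz)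
    rw [hP.profile.at_zero, ← hα] at this
    exact lt_irrefl _ this
  · exact h0

theorem Params.Admissible.isEquilibrium_iff (hP : P.Admissible) (H : IsReference hs) :
    P.IsEquilibrium hs h z ↔
      (∀ t, 0 ≤ t → h t = hs t ∧ z t = 0) ∨ (∀ t, 0 ≤ t → h t = -hs t ∧ z t = 0) := by
  constructor
  · intro E
    have hc := E.isSolution.continuousOn_inner H le_rfl
    have hsq : ∀ t ∈ Set.Ici (0 : ℝ), ⟪h t, hs t⟫_ℝ ^ 2 = 1 := fun t ht => by
      have h1 := norm_cross_sq_of_unit (E.isSolution.norm_eq_one t ht) (H.norm_eq_one t ht)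
      rw [(E.eq_zero hP ht).2, norm_zero] at h1
      linarith
    -- Connectedness of the time axis prevents switching between `h*` and `-h*`.
    rcases isPreconnected_Ici.eq_one_or_eq_neg_one_of_sq_eq hc hsq with h1 | h1
    · refine .inl fun t ht => ⟨?_, (E.eq_zero hP ht).1⟩
      have h2 := norm_sub_sq_of_unit (E.isSolution.norm_eq_one t ht) (H.norm_eq_one t ht)
      rw [show ⟪h t, hs t⟫_ℝ = _ from h1 ht] at h2
      simpa [sub_eq_zero] using h2
    · refine .inr fun t ht => ⟨?_, (E.eq_zero hP ht).1⟩
      have h2 := norm_add_sq_of_unit (E.isSolution.norm_eq_one t ht) (H.norm_eq_one t ht)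
      rw [show ⟪h t, hs t⟫_ℝ = _ from h1 ht] at h2
      simpa [sub_eq_zero, add_eq_zero_iff_eq_neg] using h2
  · rintro (hh | hh)
    · exact hP.isEquilibrium H (σ := 1) (by norm_num) (by simpa using hh)
    · exact hP.isEquilibrium H (σ := -1) (by norm_num) (by simpa using hh)

end Equilibria

/-! ### The saturation is continuously differentiable -/

/-- The norm is not differentiable at `0`, but `α'(0) = 0` makes the composition flat there, and the
gradient `α'(|y|) y/|y|` extends continuously by `0`. -/
lemma IsSatProfile.contDiff_comp_norm {Δ : ℝ} {α : ℝ → ℝ} (hα : IsSatProfile Δ α) {F : Type*}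
    [NormedAddCommGroup F] [InnerProductSpace ℝ F] : ContDiff ℝ 1 fun y : F => α ‖y‖ := by
  set α' : ℝ → ℝ := derivWithin α (Set.Ici 0)
  have hα' : Continuous fun y : F => α' ‖y‖ :=
    hα.diff_two.continuousOn.comp_continuous continuous_norm fun y => norm_nonneg y
  refine contDiff_one_iff_hasFDerivAt.2 ⟨fun y => (α' ‖y‖ / ‖y‖) • innerSL ℝ y, ?_, fun y => ?_⟩
  · refine continuous_iff_continuousAt.2 fun y => ?_
    rcases eq_or_ne y 0 with rfl | hy
    · rw [ContinuousAt, map_zero, smul_zero]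
      have h0 : Tendsto (fun y : F => |α' ‖y‖|) (𝓝 0) (𝓝 0) := by
        have := (hα'.tendsto 0).abs
        rwa [norm_zero, show α' 0 = 0 from hα.deriv_zero, abs_zero] at this
      refine squeeze_zero_norm (fun y => ?_) h0
      rw [norm_smul, innerSL_apply_norm, norm_div, norm_norm, Real.norm_eq_abs]
      rcases eq_or_ne ‖y‖ 0 with h | h
      · rw [h, mul_zero]; exact abs_nonneg _
      · rw [div_mul_cancel₀ _ h]
    · exact (hα'.continuousAt.div continuous_norm.continuousAt (norm_ne_zero_iff.2 hy)).smul
        (innerSL ℝ).continuous.continuousAt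
  · rcases eq_or_ne y 0 with rfl | hy
    · simp only [map_zero, smul_zero]
      have h1 := (hα.diff 0 Set.self_mem_Ici).hasDerivWithinAt
      rw [hα.deriv_zero, hasDerivWithinAt_iff_isLittleO] at h1
      have h2 : Tendsto (fun y : F => ‖y‖) (𝓝 0) (𝓝[Set.Ici 0] 0) :=
        tendsto_nhdsWithin_iff.2 ⟨by simpa using continuous_norm.tendsto (0 : F),
          Eventually.of_forall fun y => norm_nonneg y⟩
      have h3 := h1.comp_tendsto h2
      refine .of_isLittleO ?_
      simpa [Function.comp_def, ← Asymptotics.isLittleO_norm_right] using h3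
    · have hpos := norm_pos_iff.2 hy
      have h1 : HasDerivAt α (α' ‖y‖) ‖y‖ :=
        ((hα.diff _ hpos.le).hasDerivWithinAt).hasDerivAt (Ici_mem_nhds hpos)
      have h2 := ((hasStrictFDerivAt_norm_sq y).hasFDerivAt.sqrt (by positivity))
      simp only [Real.sqrt_sq (norm_nonneg _)] at h2
      refine (h1.comp_hasFDerivAt y h2).congr_fderiv ?_
      ext v
      simp
      field_simp

/-! ### Global solutions of ordinary differential equations with a `C¹` right-hand side -/

section GlobalExistence

variable {X Y : Type*} [NormedAddCommGroup X] [NormedSpace ℝ X] [FiniteDimensional ℝ X]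
  [NormedAddCommGroup Y] [NormedSpace ℝ Y] [FiniteDimensional ℝ Y] {Φ : Y × X → X}
  {p : ℝ → Y} {a b : ℝ}

/-- The equation with a right-hand side that is cut off outside a ball has a solution on every
compact interval. -/
lemma exists_solution_cutoff (hΦ : ContDiff ℝ 1 Φ) (hab : a ≤ b) (hp : ContinuousOn p (Set.Icc a b))
    {R : ℝ} (hR : 0 < R) (hpR : ∀ t ∈ Set.Icc a b, ‖p t‖ ≤ R) (x₀ : X) :
    ∃ (χ : ℝ → ℝ) (x : ℝ → X), x a = x₀ ∧ (∀ t, 0 ≤ χ t ∧ χ t ≤ 1) ∧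
      (∀ t ∈ Set.Icc a b, HasDerivWithinAt x (χ t • Φ (p t, x t)) (Set.Icc a b) t) ∧
      ∀ t ∈ Set.Icc a b, ‖x t‖ ≤ R → χ t = 1 := by
  let f : ContDiffBump (0 : Y × X) := ⟨R, 2 * R, hR, by linarith⟩
  set G : Y × X → X := fun y => f y • Φ y with hG
  have hGc : HasCompactSupport G := f.hasCompactSupport.smul_right
  have hGd : ContDiff ℝ 1 G := f.contDiff.smul hΦ
  obtain ⟨K, hK⟩ := hGd.lipschitzWith_of_hasCompactSupport hGc one_ne_zero
  obtain ⟨L, hL⟩ := hGc.exists_bound_of_continuous hGd.continuous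
  have hL0 : 0 ≤ L := (norm_nonneg _).trans (hL 0)
  -- The cut-off field is bounded by `L` everywhere, so a ball of radius `L (b - a)` lets
  -- Picard–Lindelöf cover the whole interval at once.
  have hPL : IsPicardLindelof (fun t x => G (p t, x)) (⟨a, le_rfl, hab⟩ : Set.Icc a b) x₀
      (.mk (L * (b - a)) (mul_nonneg hL0 (sub_nonneg.2 hab))) 0 (.mk L hL0) K := by
    refine ⟨fun t _ => ?_, fun x _ => ?_, fun t _ x _ => hL _, ?_⟩
    · refine LipschitzWith.lipschitzOnWith ?_
      simpa [Function.comp_def] using hK.comp (LipschitzWith.prodMk_left (p t))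
    · exact hGd.continuous.comp_continuousOn (hp.prodMk continuousOn_const)
    · simp [hab]
  obtain ⟨x, hxa, hx⟩ := hPL.exists_eq_forall_mem_Icc_hasDerivWithinAt₀
  refine ⟨fun t => f (p t, x t), x, hxa, fun t => ⟨f.nonneg, f.le_one⟩, hx, fun t ht hxt => ?_⟩
  refine f.one_of_mem_closedBall ?_
  rw [mem_closedBall_zero_iff, Prod.norm_def]
  exact max_le (hpR t ht) hxt

/-- On a compact interval both solutions and the parameter stay in one ball, on which `Φ` is
Lipschitz. -/
lemma eqOn_Icc_of_hasDerivWithinAt (hΦ : ContDiff ℝ 1 Φ) (hp : ContinuousOn p (Set.Icc a b))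
    {x y : ℝ → X}
    (hx : ∀ t ∈ Set.Icc a b, HasDerivWithinAt x (Φ (p t, x t)) (Set.Icc a b) t)
    (hy : ∀ t ∈ Set.Icc a b, HasDerivWithinAt y (Φ (p t, y t)) (Set.Icc a b) t)
    (hxy : x a = y a) : Set.EqOn x y (Set.Icc a b) := by
  have hxc : ContinuousOn x (Set.Icc a b) := fun t ht => (hx t ht).continuousWithinAt
  have hyc : ContinuousOn y (Set.Icc a b) := fun t ht => (hy t ht).continuousWithinAt
  obtain ⟨Rp, hRp⟩ := isCompact_Icc.exists_bound_of_continuousOn hp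
  obtain ⟨Rx, hRx⟩ := isCompact_Icc.exists_bound_of_continuousOn hxc
  obtain ⟨Ry, hRy⟩ := isCompact_Icc.exists_bound_of_continuousOn hyc
  set R := max Rp (max Rx Ry)
  obtain ⟨K, hK⟩ := hΦ.contDiffOn.exists_lipschitzOnWith one_ne_zero
    (convex_closedBall (0 : Y × X) R) (isCompact_closedBall _ _)
  have hmem : ∀ {q : Y} {v : X}, ‖q‖ ≤ R → ‖v‖ ≤ R → (q, v) ∈ Metric.closedBall (0 : Y × X) R :=
    fun hq hv => by rw [mem_closedBall_zero_iff, Prod.norm_def]; exact max_le hq hv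
  have hright : ∀ {w : ℝ → X}, (∀ t ∈ Set.Icc a b,
      HasDerivWithinAt w (Φ (p t, w t)) (Set.Icc a b) t) → ∀ t ∈ Set.Ico a b,
      HasDerivWithinAt w (Φ (p t, w t)) (Set.Ici t) t := fun hw t ht =>
    (hw t ⟨ht.1, ht.2.le⟩).mono_of_mem_nhdsWithin (Icc_mem_nhdsGE_of_mem ht)
  refine ODE_solution_unique_of_mem_Icc_right (v := fun t v => Φ (p t, v)) (K := K)
    (s := fun _ => Metric.closedBall 0 R) (fun t ht => ?_) hxc (hright hx) (fun t ht => ?_) hyc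
    (hright hy) (fun t ht => ?_) hxy
  · intro u hu v hv
    have hpt : ‖p t‖ ≤ R := (hRp t ⟨ht.1, ht.2.le⟩).trans (le_max_left _ _)
    have := hK (hmem hpt (mem_closedBall_zero_iff.1 hu)) (hmem hpt (mem_closedBall_zero_iff.1 hv))
    simpa [Prod.edist_eq] using this
  · exact mem_closedBall_zero_iff.2 ((hRx t ⟨ht.1, ht.2.le⟩).trans
      ((le_max_left _ _).trans (le_max_right _ _)))
  · exact mem_closedBall_zero_iff.2 ((hRy t ⟨ht.1, ht.2.le⟩).trans
      ((le_max_right _ _).trans (le_max_right _ _)))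

/-- A nonautonomous equation with a `C¹` right-hand side has a global forward solution if the
solutions of the rescaled equations `x' = χ Φ`, `0 ≤ χ ≤ 1`, satisfy an a priori bound on every
compact interval. -/
theorem exists_global_solution (hΦ : ContDiff ℝ 1 Φ) (hp : ContinuousOn p (Set.Ici a)) (x₀ : X)
    (hbound : ∀ b, a ≤ b → ∃ R : ℝ, ∀ (χ : ℝ → ℝ) (x : ℝ → X), x a = x₀ →
      (∀ t, 0 ≤ χ t ∧ χ t ≤ 1) →
      (∀ t ∈ Set.Icc a b, HasDerivWithinAt x (χ t • Φ (p t, x t)) (Set.Icc a b) t) →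
      ∀ t ∈ Set.Icc a b, ‖x t‖ ≤ R) :
    ∃ x : ℝ → X, x a = x₀ ∧ ∀ t, a ≤ t → HasDerivWithinAt x (Φ (p t, x t)) (Set.Ici a) t := by
  have hloc : ∀ n : ℕ, ∃ x : ℝ → X, x a = x₀ ∧ ∀ t ∈ Set.Icc a (a + n),
      HasDerivWithinAt x (Φ (p t, x t)) (Set.Icc a (a + n)) t := fun n => by
    have hab : a ≤ a + n := le_add_of_nonneg_right n.cast_nonneg
    have hpc := hp.mono (Set.Icc_subset_Ici_self : Set.Icc a (a + n) ⊆ _)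
    obtain ⟨Rp, hRp⟩ := isCompact_Icc.exists_bound_of_continuousOn hpc
    obtain ⟨R, hR⟩ := hbound (a + n) hab
    obtain ⟨χ, x, hxa, hχ, hx, hχ1⟩ := exists_solution_cutoff hΦ hab hpc
      (R := max 1 (max Rp R)) (lt_max_of_lt_left one_pos)
      (fun t ht => (hRp t ht).trans ((le_max_left _ _).trans (le_max_right _ _))) x₀
    refine ⟨x, hxa, fun t ht => ?_⟩
    -- The a priori bound keeps the solution where the cut-off is inactive.
    have h1 := hχ1 t ht ((hR χ x hxa hχ hx t ht).trans
      ((le_max_right _ _).trans (le_max_right _ _)))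
    have h2 := hx t ht
    rwa [h1, one_smul] at h2
  choose x hxa hx using hloc
  have hle : ∀ m n : ℕ, m ≤ n → Set.EqOn (x m) (x n) (Set.Icc a (a + m)) := fun m n hmn => by
    have hsub : Set.Icc a (a + m) ⊆ Set.Icc a (a + n) :=
      Set.Icc_subset_Icc_right (by gcongr)
    exact eqOn_Icc_of_hasDerivWithinAt hΦ
      (hp.mono (Set.Icc_subset_Ici_self : Set.Icc a (a + m) ⊆ _)) (hx m)
      (fun t ht => (hx n t (hsub ht)).mono hsub) ((hxa m).trans (hxa n).symm)
  have hglue : ∀ n : ℕ, Set.EqOn (fun t => x ⌈t - a⌉₊ t) (x n) (Set.Icc a (a + n)) := fun n t ht => by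
    have h1 : t ∈ Set.Icc a (a + ⌈t - a⌉₊) := ⟨ht.1, by linarith [Nat.le_ceil (t - a)]⟩
    rcases le_total ⌈t - a⌉₊ n with h | h
    · exact hle _ _ h h1
    · exact (hle _ _ h ht).symm
  refine ⟨fun t => x ⌈t - a⌉₊ t, hxa _, fun t ht => ?_⟩
  -- The strict inequality makes `[a, a + n]` a neighbourhood of `t` within `[a, ∞)`.
  obtain ⟨n, hn⟩ := exists_nat_gt (t - a)
  have htn : t ∈ Set.Icc a (a + n) := ⟨ht, by linarith⟩
  have h1 := (hx n t htn).congr (hglue n) (hglue n htn)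
  rw [← hglue n htn] at h1
  refine h1.mono_of_mem_nhdsWithin ?_
  rw [← Set.Ici_inter_Iic]
  exact inter_mem_nhdsWithin _ (Iic_mem_nhds (by linarith))

end GlobalExistence

/-! ### Existence of solutions of the heading system, and instability -/

section Instability

variable {P : Params} {hs : ℝ → E3} {t₀ : ℝ}

/-- The right-hand side of the residual-free system, as a function of `((ω_{h*}, h*), (h, z))`. -/
noncomputable def Params.field (P : Params) (y : (E3 × E3) × E3 × E3) : E3 × E3 :=
  (cross (y.1.1 + P.kh1 • cross y.2.1 y.1.2
      + (P.kh2 * P.α ‖y.2.2 + P.kz⁻¹ • cross y.2.1 y.1.2‖) • y.2.2) y.2.1,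
    cross y.1.1 y.2.2 + P.kz • (-y.2.2 + P.sat (y.2.2 + P.kz⁻¹ • cross y.2.1 y.1.2)))

lemma Params.Admissible.contDiff_field (hP : P.Admissible) : ContDiff ℝ 1 P.field := by
  have h1 : ContDiff ℝ 1 fun y : (E3 × E3) × E3 × E3 => cross y.2.1 y.1.2 :=
    ContDiff.cross (by fun_prop) (by fun_prop)
  have h2 : ContDiff ℝ 1 fun y : (E3 × E3) × E3 × E3 => y.2.2 + P.kz⁻¹ • cross y.2.1 y.1.2 := by
    fun_prop
  have h3 : ContDiff ℝ 1 fun y : (E3 × E3) × E3 × E3 =>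
      P.α ‖y.2.2 + P.kz⁻¹ • cross y.2.1 y.1.2‖ := hP.profile.contDiff_comp_norm.comp h2
  have h4 : ContDiff ℝ 1 fun y : (E3 × E3) × E3 × E3 => cross y.1.1 y.2.2 :=
    ContDiff.cross (by fun_prop) (by fun_prop)
  refine ContDiff.prodMk (ContDiff.cross (by fun_prop) (by fun_prop)) ?_
  unfold sat
  fun_prop

lemma Params.Admissible.norm_sat_le (hP : P.Admissible) (y : E3) : ‖P.sat y‖ ≤ P.Δz := by
  rcases eq_or_ne y 0 with rfl | hy
  · simpa [sat] using hP.Δz_pos.le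
  · have hpos := norm_pos_iff.2 hy
    rw [sat, norm_smul, Real.norm_of_nonneg (hP.profile.mem_Ioc _ hpos.le).1.le]
    exact (le_div_iff₀ hpos).1 (hP.profile.le_div _ hpos)

/-- For every `C¹` reference the residual-free system can be solved from every unit heading. -/
theorem Params.Admissible.exists_isSolution (hP : P.Admissible)
    (hC : ContDiffOn ℝ 1 hs (Set.Ici 0)) (h0 : 0 ≤ t₀) {h₀ : E3} (hh₀ : ‖h₀‖ = 1) :
    ∃ h z : ℝ → E3, P.IsSolution hs (fun _ => 0) t₀ h z ∧ h t₀ = h₀ ∧ z t₀ = 0 := by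
  have hkz := hP.kz_pos
  have hω : ContinuousOn (omegaRef hs) (Set.Ici 0) :=
    hC.continuousOn.cross (hC.continuousOn_derivWithin (uniqueDiffOn_Ici 0) le_rfl)
  have hp : ContinuousOn (fun t => (omegaRef hs t, hs t)) (Set.Ici t₀) :=
    (hω.prodMk hC.continuousOn).mono (Set.Ici_subset_Ici.2 h0)
  have hfst : ∀ {x : ℝ → E3 × E3} {v : E3 × E3} {s : Set ℝ} {t : ℝ}, HasDerivWithinAt x v s t →
      HasDerivWithinAt (fun t => (x t).1) v.1 s t := fun hx =>
    (ContinuousLinearMap.fst ℝ E3 E3).hasFDerivAt.comp_hasDerivWithinAt _ hx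
  have hsnd : ∀ {x : ℝ → E3 × E3} {v : E3 × E3} {s : Set ℝ} {t : ℝ}, HasDerivWithinAt x v s t →
      HasDerivWithinAt (fun t => (x t).2) v.2 s t := fun hx =>
    (ContinuousLinearMap.snd ℝ E3 E3).hasFDerivAt.comp_hasDerivWithinAt _ hx
  -- The heading velocity stays orthogonal to `h` after rescaling by `χ`, so `|h|` is conserved for
  -- the cut-off equations too.
  have hnorm : ∀ {b : ℝ} {χ : ℝ → ℝ} {x : ℝ → E3 × E3}, x t₀ = (h₀, 0) →
      (∀ t ∈ Set.Icc t₀ b,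
        HasDerivWithinAt x (χ t • P.field ((omegaRef hs t, hs t), x t)) (Set.Icc t₀ b) t) →
      ∀ t ∈ Set.Icc t₀ b, ‖(x t).1‖ = 1 := fun {b χ x} hx0 hx t ht => by
    have h1 : ∀ s ∈ Set.Icc t₀ b, HasDerivWithinAt (fun s => ‖(x s).1‖ ^ 2) 0 (Set.Icc t₀ b) s :=
      fun s hs => (hfst (hx s hs)).norm_sq.congr_deriv <| by
        rw [Prod.smul_fst, field, real_inner_smul_right, real_inner_comm,
          inner_cross_self_right, mul_zero, mul_zero]
    have h2 := constant_of_has_deriv_right_zero (fun s hs => (h1 s hs).continuousWithinAt)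
      (fun s hs => (h1 s ⟨hs.1, hs.2.le⟩).mono_of_mem_nhdsWithin (Icc_mem_nhdsGE_of_mem hs)) t ht
    simp only [hx0, hh₀, one_pow] at h2
    exact (pow_eq_one_iff_of_nonneg (norm_nonneg _) two_ne_zero).1 h2
  obtain ⟨x, hx0, hx⟩ := exists_global_solution hP.contDiff_field hp (h₀, 0) fun b hb => by
    refine ⟨1 + P.kz * P.Δz ^ 2 * (b - t₀), fun χ x hx0 hχ hx t ht => ?_⟩
    have hpos : 0 ≤ P.kz * P.Δz ^ 2 * (b - t₀) := by
      have := sub_nonneg.2 hb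
      positivity
    -- By `2(-w² + wΔ) ≤ Δ²`, the function `|z|²` grows at most linearly, whatever `χ` between `0`
    -- and `1`.
    have hz : ‖(x t).2‖ ^ 2 ≤ P.kz * P.Δz ^ 2 * (t - t₀) := by
      have hanti : AntitoneOn (fun s => ‖(x s).2‖ ^ 2 - P.kz * P.Δz ^ 2 * s) (Set.Icc t₀ b) := by
        have h1 := fun s (hs' : s ∈ Set.Icc t₀ b) => (hsnd (hx s hs')).norm_sq.sub
          ((hasDerivWithinAt_id s (Set.Icc t₀ b)).const_mul (P.kz * P.Δz ^ 2))
        refine antitoneOn_of_hasDerivWithinAt_nonpos (convex_Icc t₀ b)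
          (fun s hs => (h1 s hs).continuousWithinAt)
          (fun s hs => (h1 s (interior_subset hs)).mono interior_subset) fun s hs' => ?_
        rw [Prod.smul_snd, field]
        dsimp only
        set y := (x s).2 + P.kz⁻¹ • cross (x s).1 (hs s)
        rw [real_inner_smul_right, inner_add_right, real_inner_comm, inner_cross_self_right,
          zero_add, real_inner_smul_right, inner_add_right, inner_neg_right,
          real_inner_self_eq_norm_sq]
        have h2 : ⟪(x s).2, P.sat y⟫_ℝ ≤ ‖(x s).2‖ * P.Δz := (real_inner_le_norm _ _).trans
          (mul_le_mul_of_nonneg_left (hP.norm_sat_le y) (norm_nonneg _))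
        have h3 : 2 * (-‖(x s).2‖ ^ 2 + ⟪(x s).2, P.sat y⟫_ℝ) ≤ P.Δz ^ 2 := by
          nlinarith [sq_nonneg (‖(x s).2‖ - P.Δz), sq_nonneg ‖(x s).2‖]
        have h4 : χ s * (2 * (-‖(x s).2‖ ^ 2 + ⟪(x s).2, P.sat y⟫_ℝ)) ≤ P.Δz ^ 2 :=
          (mul_le_mul_of_nonneg_left h3 (hχ s).1).trans
            (mul_le_of_le_one_left (sq_nonneg _) (hχ s).2)
        have h5 := mul_le_mul_of_nonneg_left h4 hkz.le
        linarith
      have h6 := hanti (Set.left_mem_Icc.2 hb) ht ht.1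
      simp only [hx0, norm_zero] at h6
      linarith
    have hz' : P.kz * P.Δz ^ 2 * (t - t₀) ≤ P.kz * P.Δz ^ 2 * (b - t₀) := by
      gcongr
      exact ht.2
    rw [Prod.norm_def]
    refine max_le ?_ ?_
    · rw [hnorm hx0 hx t ht]; linarith
    · nlinarith [sq_nonneg (‖(x t).2‖ - 1)]
  refine ⟨fun t => (x t).1, fun t => (x t).2, ⟨fun t ht => ?_, fun t ht => ?_, fun t ht => ?_⟩,
    congrArg Prod.fst hx0, congrArg Prod.snd hx0⟩
  · refine hnorm (b := t) (χ := fun _ => 1) hx0 (fun s hs => ?_) t (Set.right_mem_Icc.2 ht)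
    rw [one_smul]
    exact (hx s hs.1).mono Set.Icc_subset_Ici_self
  · refine (hfst (hx t ht)).congr_deriv ?_
    rw [omegaH, add_zero, cross_planeProj]
    rfl
  · exact hsnd (hx t ht)

/-- The sphere is connected and has more than one point, so no point of it is isolated. -/
lemma exists_unit_near {k : E3} (hk : ‖k‖ = 1) {δ : ℝ} (hδ : 0 < δ) :
    ∃ h : E3, ‖h‖ = 1 ∧ h ≠ k ∧ ‖h - k‖ < δ := by
  have hrank : 1 < Module.rank ℝ E3 := by
    rw [← Module.finrank_eq_rank, finrank_euclideanSpace_fin]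
    norm_num
  have hmem : k ∈ Metric.sphere (0 : E3) 1 := by simpa using hk
  have hnt : (Metric.sphere (0 : E3) 1).Nontrivial := by
    refine ⟨k, hmem, -k, by simpa using hk, fun h => ?_⟩
    have h2 : (2 : ℝ) • k = 0 := by rw [two_smul]; nth_rw 1 [h]; exact neg_add_cancel k
    rw [(smul_eq_zero.1 h2).resolve_left two_ne_zero, norm_zero] at hk
    exact zero_ne_one hk
  have hacc := (isPreconnected_sphere hrank 0 1).preperfect_of_nontrivial hnt k hmem
  obtain ⟨h, ⟨hne, hh⟩, hd⟩ := ((accPt_iff_frequently.1 hacc).and_eventually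
    (Metric.ball_mem_nhds k hδ)).exists
  exact ⟨h, by simpa using hh, hne, by rwa [← dist_eq_norm]⟩

theorem Params.Admissible.unstable (hP : P.Admissible) (H : IsReference hs)
    (hC : ContDiffOn ℝ 1 hs (Set.Ici 0)) : P.Unstable hs fun t => -hs t := by
  -- The threshold `1` works since `h*` and `-h*` are at distance `2` and the solution eventually
  -- stays within `1` of `h*`.
  refine fun t₀ h0 => ⟨1, one_pos, fun δ hδ => ?_⟩
  obtain ⟨h₀, hh₀, hne, hnear⟩ := exists_unit_near (k := -hs t₀)
    (by rw [norm_neg, H.norm_eq_one t₀ h0]) hδ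
  obtain ⟨h, z, S, hh, hz⟩ := hP.exists_isSolution hC h0 hh₀
  refine ⟨h, z, S, hz, by rwa [hh], ?_⟩
  have hE : P.energy hs h z t₀ < 2 := by
    have := inner_lt_of_ne_neg hh₀ (H.norm_eq_one t₀ h0) hne
    rw [energy, hz, hh, norm_zero]
    linarith
  have hconv := S.convergesTo_of_energy_lt hP H h0 hE
  obtain ⟨t, ht, hte⟩ := ((eventually_ge_atTop t₀).and
    (hconv.eventually_le_const one_pos)).exists
  refine ⟨t, ht, ?_⟩
  have h1 : ‖h t - hs t‖ ≤ 1 := (le_add_of_nonneg_right (norm_nonneg _)).trans hte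
  have h2 : 2 * ‖hs t‖ ≤ ‖h t - -hs t‖ + ‖h t - hs t‖ := by
    have := norm_sub_le (h t - -hs t) (h t - hs t)
    rwa [show h t - -hs t - (h t - hs t) = (2 : ℝ) • hs t by module, norm_smul,
      Real.norm_ofNat] at this
  rw [H.norm_eq_one t (h0.trans ht)] at h2
  unfold err
  linarith [norm_nonneg (z t)]

end Instability

end HeadingControl

/-! ### The main theorem -/

theorem proposition3 (P : HeadingControl.Params) (hP : P.Admissible) :
    -- Case 1, local exponential stability of `(h*, 0)`; the constants depend on `P` only
    (∃ δ K lam : ℝ, 0 < δ ∧ 0 < K ∧ 0 < lam ∧ ∀ hs : ℝ → HeadingControl.E3,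
      HeadingControl.IsReference hs → P.ExpStableWith δ K lam hs hs) ∧
    ∀ hs : ℝ → HeadingControl.E3, HeadingControl.IsReference hs →
      -- Case 1, the equilibria are exactly `(h*, 0)` and `(-h*, 0)`
      (∀ h z : ℝ → HeadingControl.E3, P.IsEquilibrium hs h z ↔
        (∀ t, 0 ≤ t → h t = hs t ∧ z t = 0) ∨ (∀ t, 0 ≤ t → h t = -hs t ∧ z t = 0)) ∧
      -- Case 1, instability of `(-h*, 0)`
      (ContDiffOn ℝ 1 hs (Set.Ici 0) → P.Unstable hs (fun t => -hs t)) ∧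
      -- Case 1, convergence
      (∀ h z : ℝ → HeadingControl.E3, P.IsSolution hs (fun _ => 0) 0 h z → z 0 = 0 →
        h 0 ≠ -hs 0 → HeadingControl.ConvergesTo hs h z) ∧
      -- Case 2 (for every residual `o`, whether or not it vanishes)
      (∀ o h z : ℝ → HeadingControl.E3, HeadingControl.BoundedIntegral o →
        P.IsSolution hs o 0 h z → z 0 = 0 →
        ¬ HeadingControl.ConvergesTo (fun t => -hs t) h z →
        HeadingControl.ConvergesTo hs h z ∧
        (HeadingControl.UltimatelyExp (fun t => ‖o t‖) →
          HeadingControl.UltimatelyExp (HeadingControl.err hs h z))) := by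
  refine ⟨hP.expStableWith, fun hs H => ⟨fun h z => hP.isEquilibrium_iff H, hP.unstable H,
    fun h z S hz hne => ?_, fun o h z ho S hz hne => ?_⟩⟩
  -- With `z(0) = 0` the initial energy is `1 - h·h*`, below `2` except at the antipode.
  · refine S.convergesTo_of_energy_lt hP H le_rfl ?_
    have := HeadingControl.inner_lt_of_ne_neg (S.norm_eq_one 0 le_rfl) (H.norm_eq_one 0 le_rfl) hne
    rw [HeadingControl.Params.energy, hz, norm_zero]
    linarith
  · have hconv := (S.convergesTo_or hP H le_rfl ho.integrableOn).resolve_right hne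
    exact ⟨hconv, S.ultimatelyExp_err hP H le_rfl (by rw [hz, inner_zero_left]) hconv⟩
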